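/- **Theorem (Euclidean spaces).** For any fixed integers $p,d>0$ there is a constant $c=c(p,d)\in\mathbb N$ such that the following holds for every $0<\varepsilon<1/2$, every integer $k\ge 1$ and every finite set $C\subset\mathbb R^d$ of $n$ points. For a nonempty finite set $S\subset\mathbb R^d$ let $$\mathrm{cost}(S)=\sum_{x\in C}\Bigl(\min_{u\in S}\|x-u\|_2\Bigr)^p ,$$ and put $s=\lfloor 1/\varepsilon^{c}\rfloor$. Consider the following local search algorithm: start with an arbitrary set $S\subset\mathbb R^d$ of exactly $k$ points; as long as there is a nonempty $S'\subset\mathbb R^d$ with $|S'|\le k$, $|S\setminus S'|+|S'\setminus S|\le s$, $\mathrm{cost}(S')\le(1-\varepsilon/n)\,\mathrm{cost}(S)$ and $\mathrm{cost}(S')<\mathrm{cost}(S)$, replace $S$ by an arbitrary such $S'$; when there is none, output $S$. (The last condition follows from the preceding one unless $\mathrm{cost}(S)=0$, so it only makes the loop stop at zero cost.) Then, for every choice of the initial set and of the replacements, any set $S$ that the algorithm outputs is a nonempty set of at most $k$ points with $$\mathrm{cost}(S)\le(1+\varepsilon)\,\mathrm{cost}(T)\qquad\text{for every nonempty } T\subset\mathbb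 R^d \text{ with } |T|\le k ,$$ that is, its cost is at most $1+\varepsilon$ times the minimum. Moreover, if $n>k$ (equivalently, if the minimum cost is positive), the algorithm halts after finitely many iterations. For $p=2$ this is the $k$-means objective, for $p=1$ the $k$-median objective. -/

import Mathlib

namespace KClustering

noncomputable section

variable {X : Type*} [MetricSpace X]

/-- `cost(S) = ∑_{x ∈ C} (min_{u ∈ S} dist(x, u))^p`. It is used for nonempty finite `S` only, where
the infimum `Metric.infDist x S` is the minimum of the distances from `x` to the points of `S`. -/
def cost (p : ℕ) (C S : Finset X) : ℝ :=
  ∑ x ∈ C, (Metric.infDist x (S : Set X)) ^ p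

/-- A solution of the `k`-clustering problem: a nonempty set of at most `k` centers, which may be
any points of the ambient space. -/
def IsSolution (k : ℕ) (S : Finset X) : Prop :=
  S.Nonempty ∧ S.card ≤ k

open Classical in
/-- `Step p k s ε C S S'`: the loop of local search may replace `S` by `S'`. That is, `S'` has at
most `k` centers, it differs from `S` in at most `s` points, and
`cost(S') ≤ (1 - ε/n) cost(S)`, where `n = |C|`.
The clause `cost(S') < cost(S)` follows from the previous one when `cost(S) > 0`; it only makes the
loop stop (instead of replacing `S` by itself forever) once the cost is zero. -/
def Step (p k s : ℕ) (ε : ℝ) (C S S' : Finset X) : Prop :=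
  IsSolution k S' ∧
  (S \ S').card + (S' \ S).card ≤ s ∧
  cost p C S' ≤ (1 - ε / (C.card : ℝ)) * cost p C S ∧
  cost p C S' < cost p C S

/-- `S` is an output of local search started from `S₀`: some sequence of loop iterations leads from
`S₀` to `S`, and the loop stops at `S`. -/
def IsOutput (p k s : ℕ) (ε : ℝ) (C S₀ S : Finset X) : Prop :=
  Relation.ReflTransGen (Step p k s ε C) S₀ S ∧ ∀ S', ¬ Step p k s ε C S S'

/-- `run` is a nonterminating execution of local search started from `S₀`. -/
def IsInfiniteRun (p k s : ℕ) (ε : ℝ) (C S₀ : Finset X) (run : ℕ → Finset X) : Prop :=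
  run 0 = S₀ ∧ ∀ i, Step p k s ε C (run i) (run (i + 1))

end

end KClustering

/-! Compare a local optimum `L` with `k` centers to any `G` with `k` centers. Label all centers and,
for each label, exchange the centers of `L` for those of `G` and some extra portals. A client `x`
with centers `σ x ∈ L`, `τ x ∈ G` notices only the exchanges of these two labels. If losing `σ x`
always leaves a substitute within the larger of its two distances, then it pays the maximum in one
exchange and the minimum in the other, and maximum plus minimum is the sum. Hence all exchanges
together change the cost by at most about `cost(G) - cost(L)` (`sum_swap_cost_le`). Local optimality
bounds each change below by `-(ε/n) cost(L)`, so about `k/10` small exchanges that respect the bound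
`k` suffice.

Substitutes come from geometry: recursive sphere separators (`exists_separator`, `exists_division`)
cut the centers into regions of size polynomial in `1/η`, with few boundary points, so that a ball
meeting two regions contains a boundary point of each. Boundary points are the portals.

Portals exceed the budget `k`, so some centers of `G` are given up (`exists_removal`). A center `f ∈
G` is tight if few clients disagree with their `L`-centers about belonging to `f`. A tight `f` with
exactly one partner in `L` can form an isolated pair, kept out of the division; the detour between
the two is charged to clients both of them serve. At least half of the centers of `G` outside such
pairs are loose. Removing a loose center is charged to its mismatched clients, so a `δ` fraction can
be removed cheaply, and it pays for the portals.

One exchange may still open too many centers, but on the whole no more are opened than closed.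
`exists_balanced_grouping` merges the exchanges into groups of bounded size, none of which opens
more than it closes. -/

namespace KClustering

/-! ### Nets and dense balls -/

section

open Classical in
-- Round down to a grid of mesh `ρ / (d * K)`: an error of at most one mesh in each of `d`
-- coordinates is at most `ρ / K` in norm. Each coordinate takes `6 * d * K + 1 ≤ 7 * d * K` values.
theorem exists_net {d : ℕ} (hd : 0 < d) (K : ℕ) (hK : 0 < K)
    (o : EuclideanSpace ℝ (Fin d)) (ρ : ℝ) (hρ : 0 < ρ) :
    ∃ N : Finset (EuclideanSpace ℝ (Fin d)), N.card ≤ (7 * d * K) ^ d ∧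
      ∀ x, dist x o ≤ 3 * ρ → ∃ z ∈ N, dist x z ≤ ρ / K := by
  have hd' : (0 : ℝ) < d := by exact_mod_cast hd
  have hK' : (0 : ℝ) < K := by exact_mod_cast hK
  set M : ℝ := d * K with hM
  have hM0 : 0 < M := by positivity
  let I : Finset (Fin d → ℤ) := Fintype.piFinset fun _ => Finset.Icc (-(3 * d * K : ℤ)) (3 * d * K : ℤ)
  let pt : (Fin d → ℤ) → EuclideanSpace ℝ (Fin d) :=
    fun v => o + WithLp.toLp 2 fun i => (v i : ℝ) * (ρ / M)
  refine ⟨I.image pt, ?_, ?_⟩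
  · refine Finset.card_image_le.trans ?_
    rw [Fintype.card_piFinset]
    simp only [Int.card_Icc, Finset.prod_const, Finset.card_univ, Fintype.card_fin]
    refine Nat.pow_le_pow_left ?_ d
    have : 1 ≤ d * K := Nat.mul_pos hd hK
    have h1 : (3 * d * K + 1 - -(3 * d * K) : ℤ) = ((6 * (d * K) + 1 : ℕ) : ℤ) := by
      push_cast; ring
    rw [h1, Int.toNat_natCast]
    nlinarith
  · intro x hx
    have hcoord : ∀ i, |x i - o i| ≤ 3 * ρ := by
      intro i
      have := PiLp.norm_apply_le (x - o) i
      rw [← dist_eq_norm] at this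
      simpa using this.trans hx
    let v : Fin d → ℤ := fun i => ⌊(x i - o i) * (M / ρ)⌋
    refine ⟨pt v, Finset.mem_image_of_mem _ ?_, ?_⟩
    · rw [Fintype.mem_piFinset]
      intro i
      have h := abs_le.mp (hcoord i)
      have hq : 0 < M / ρ := by positivity
      have e1 : 3 * ρ * (M / ρ) = 3 * d * K := by rw [hM]; field_simp
      rw [Finset.mem_Icc]
      constructor
      · apply Int.le_floor.mpr
        push_cast
        nlinarith
      · have : ((x i - o i) * (M / ρ)) ≤ ((3 * d * K : ℤ) : ℝ) := by
          push_cast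
          nlinarith
        have h2 := (Int.floor_le ((x i - o i) * (M / ρ))).trans this
        show ⌊(x i - o i) * (M / ρ)⌋ ≤ _
        exact Int.cast_le.mp h2
    · have hc : ∀ i, |x i - pt v i| ≤ ρ / M := by
        intro i
        have h1 := Int.floor_le ((x i - o i) * (M / ρ))
        have h2 := (Int.lt_floor_add_one ((x i - o i) * (M / ρ))).le
        have hq : 0 < ρ / M := by positivity
        have e : (x i - o i) * (M / ρ) * (ρ / M) = x i - o i := by field_simp
        have e2 : pt v i = o i + (v i : ℝ) * (ρ / M) := by simp [pt]
        rw [e2, abs_le]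
        have h1' := mul_le_mul_of_nonneg_right h1 hq.le
        have h2' := mul_le_mul_of_nonneg_right h2 hq.le
        rw [e] at h1' h2'
        constructor <;> simp only [v] <;> nlinarith
      rw [EuclideanSpace.dist_eq]
      apply Real.sqrt_le_iff.mpr
      refine ⟨by positivity, ?_⟩
      calc ∑ i, dist (x i) (pt v i) ^ 2 ≤ ∑ _i : Fin d, (ρ / M) ^ 2 := by
            refine Finset.sum_le_sum fun i _ => ?_
            rw [Real.dist_eq]
            exact pow_le_pow_left₀ (abs_nonneg _) (hc i) 2
        _ = d * (ρ / M) ^ 2 := by simp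
        _ ≤ (ρ / K) ^ 2 := by
            rw [hM]
            have : (1 : ℝ) ≤ d := by exact_mod_cast hd
            rw [div_pow, div_pow, mul_pow, ← mul_div_assoc, div_le_div_iff₀ (by positivity) (by positivity)]
            have h3 : 0 ≤ ρ ^ 2 * (K : ℝ) ^ 2 * d * (d - 1) := by
              have : (0 : ℝ) ≤ d - 1 := by linarith
              positivity
            nlinarith

open Classical in
-- Take the smallest distance `ρ` between points of `Q` at which a ball about one of them holds a
-- share `1 / (2 * N)` of `Q`. If a ball of radius `ρ / 3` about any `u` were that rich, recentering
-- it at one of its own points would give a radius of at most `2 * ρ / 3`.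
theorem exists_dense_ball {X : Type*} [MetricSpace X] (Q : Finset X) (N : ℕ)
    (hN : 0 < N) (hQ : 2 * N < Q.card) :
    ∃ o ∈ Q, ∃ ρ : ℝ, 0 < ρ ∧ Q.card ≤ 2 * N * (Q.filter fun x => dist x o ≤ ρ).card ∧
      ∀ u : X, 2 * N * (Q.filter fun x => dist x u ≤ ρ / 3).card < Q.card := by
  let W : Finset (X × X) := (Q ×ˢ Q).filter fun a =>
    Q.card ≤ 2 * N * (Q.filter fun x => dist x a.1 ≤ dist a.2 a.1).card
  have hQne : Q.Nonempty := Finset.card_pos.mp (by omega)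
  have hW : W.Nonempty := by
    obtain ⟨q, hq⟩ := hQne
    obtain ⟨q', hq', hmax⟩ := Q.exists_max_image (fun x => dist x q) ⟨q, hq⟩
    refine ⟨(q, q'), ?_⟩
    simp only [W, Finset.mem_filter, Finset.mem_product]
    refine ⟨⟨hq, hq'⟩, ?_⟩
    rw [Finset.filter_true_of_mem hmax]
    nlinarith
  obtain ⟨⟨o, o'⟩, ho, hmin⟩ := W.exists_min_image (fun a => dist a.2 a.1) hW
  simp only [W, Finset.mem_filter, Finset.mem_product] at ho
  obtain ⟨⟨hoQ, ho'Q⟩, hcard⟩ := ho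
  have hρ : 0 < dist o' o := by
    by_contra hcon
    have h0 : dist o' o = 0 := le_antisymm (not_lt.mp hcon) dist_nonneg
    have : (Q.filter fun x => dist x o ≤ dist o' o) ⊆ {o} := by
      intro x hx
      rw [Finset.mem_filter, h0] at hx
      rw [Finset.mem_singleton]
      exact dist_le_zero.mp hx.2
    have := Finset.card_le_card this
    rw [Finset.card_singleton] at this
    nlinarith
  refine ⟨o, hoQ, dist o' o, hρ, hcard, ?_⟩
  intro u
  rcases (Q.filter fun x => dist x u ≤ dist o' o / 3).eq_empty_or_nonempty with h | ⟨q, hq⟩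
  · rw [h]; simp; omega
  · obtain ⟨q', hq', hmax⟩ := (Q.filter fun x => dist x u ≤ dist o' o / 3).exists_max_image
      (fun x => dist x q) ⟨q, hq⟩
    by_contra hcon
    push Not at hcon
    have hsub : (Q.filter fun x => dist x u ≤ dist o' o / 3) ⊆
        Q.filter fun x => dist x q ≤ dist q' q := fun x hx =>
      Finset.mem_filter.mpr ⟨(Finset.mem_filter.mp hx).1, hmax x hx⟩
    rw [Finset.mem_filter] at hq hq'
    have := hmin (q, q') (by
      simp only [W, Finset.mem_filter, Finset.mem_product]
      exact ⟨⟨hq.1, hq'.1⟩, hcon.trans (Nat.mul_le_mul_left _ (Finset.card_le_card hsub))⟩)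
    have h2 := dist_triangle_right q' q u
    simp only at this
    linarith [hq.2, hq'.2]

/-- On the segment from `a` to `x` there is a point at distance exactly `t` from `o`. -/
theorem exists_dist_eq_between {E : Type*} [NormedAddCommGroup E] [NormedSpace ℝ E]
    (a x o : E) (t : ℝ) (h : (dist a o ≤ t ∧ t ≤ dist x o) ∨ (dist x o ≤ t ∧ t ≤ dist a o)) :
    ∃ y, dist y o = t ∧ dist x y + dist y a = dist x a := by
  have hcont : Continuous fun s : ℝ => dist (AffineMap.lineMap (k := ℝ) x a s) o :=
    (AffineMap.lineMap_continuous).dist continuous_const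
  have key : ∃ s ∈ Set.Icc (0 : ℝ) 1, dist (AffineMap.lineMap (k := ℝ) x a s) o = t := by
    rcases h with h | h
    · have := intermediate_value_Icc' (zero_le_one' ℝ) hcont.continuousOn
      exact this (by simpa using h)
    · have := intermediate_value_Icc (zero_le_one' ℝ) hcont.continuousOn
      exact this (by simpa using h)
  obtain ⟨s, hs, hst⟩ := key
  refine ⟨_, hst, ?_⟩
  rw [dist_left_lineMap, dist_lineMap_right, Real.norm_eq_abs, Real.norm_eq_abs,
    abs_of_nonneg hs.1, abs_of_nonneg (by linarith [hs.2])]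
  ring

end

/-! ### Sphere separators -/

section

open Classical in
-- The radii between `ρ` and `2 * ρ` split into `K` disjoint windows; some shell holds at most the
-- average number of points.
theorem exists_thin_shell {X : Type*} [MetricSpace X] (Q : Finset X) (o : X) (ρ : ℝ)
    (hρ : 0 < ρ) (K : ℕ) (hK : 0 < K) :
    ∃ t : ℝ, ρ ≤ t ∧ t ≤ 2 * ρ ∧
      K * (Q.filter fun x => |dist x o - t| < ρ / (2 * K : ℕ)).card ≤ Q.card := by
  have hK' : (0 : ℝ) < K := by exact_mod_cast hK
  let t : ℕ → ℝ := fun j => ρ + (2 * j + 1) * (ρ / (2 * K : ℕ))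
  let sh : ℕ → Finset X := fun j => Q.filter fun x => |dist x o - t j| < ρ / (2 * K : ℕ)
  have hw : 0 < ρ / (2 * K : ℕ) := by positivity
  have hdis : ((Finset.range K : Finset ℕ) : Set ℕ).PairwiseDisjoint sh := by
    intro i _ j _ hij
    refine Finset.disjoint_left.mpr fun x hxi hxj => hij ?_
    have h1 := abs_lt.mp (Finset.mem_filter.mp hxi).2
    have h2 := abs_lt.mp (Finset.mem_filter.mp hxj).2
    simp only [t] at h1 h2
    set w := ρ / (2 * K : ℕ)
    have a1 : (i : ℝ) < j + 1 := by
      by_contra hc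
      push Not at hc
      nlinarith
    have a2 : (j : ℝ) < i + 1 := by
      by_contra hc
      push Not at hc
      nlinarith
    have a1' : i < j + 1 := by exact_mod_cast a1
    have a2' : j < i + 1 := by exact_mod_cast a2
    omega
  have hsum : ∑ j ∈ Finset.range K, (sh j).card ≤ Q.card := by
    rw [← Finset.card_biUnion hdis]
    exact Finset.card_le_card (Finset.biUnion_subset.mpr fun j _ => Finset.filter_subset _ _)
  have : ∃ j ∈ Finset.range K, K * (sh j).card ≤ Q.card := by
    apply Finset.exists_le_of_sum_le (Finset.nonempty_range_iff.mpr hK.ne')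
    rw [← Finset.mul_sum, Finset.sum_const, Finset.card_range, smul_eq_mul]
    exact Nat.mul_le_mul_left _ hsum
  obtain ⟨j, hj, hjc⟩ := this
  have hj' : (j : ℝ) + 1 ≤ K := by exact_mod_cast Finset.mem_range.mp hj
  refine ⟨t j, ?_, ?_, hjc⟩
  · simp only [t]
    have : 0 ≤ (2 * (j : ℝ) + 1) * (ρ / (2 * K : ℕ)) := by positivity
    linarith
  · simp only [t]
    have e : (2 * (K : ℝ)) * (ρ / (2 * K : ℕ)) = ρ := by push_cast; field_simp
    nlinarith

open Classical in
/-- A sphere separator: every ball that meets both `A` and `Q \ A` contains a point of `Z`. -/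
theorem exists_separator {d : ℕ} (hd : 0 < d) :
    ∃ (N C : ℕ), 0 < N ∧ ∀ Q : Finset (EuclideanSpace ℝ (Fin d)), 2 * N < Q.card →
      ∃ A ⊆ Q, ∃ Z : Finset (EuclideanSpace ℝ (Fin d)),
        Q.card ≤ 2 * N * A.card ∧ Q.card ≤ 2 * N * (Q \ A).card ∧
        (Z.card : ℝ) ≤ C * (Q.card : ℝ) ^ (1 - 1 / (2 * d) : ℝ) ∧
        ∀ x, ∀ a ∈ A, ∀ b ∈ Q \ A, ∃ z ∈ Z, dist x z ≤ max (dist x a) (dist x b) := by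
  -- This is the size of a `ρ / 3`-net, so the sparse balls of `exists_dense_ball` cover the ball of
  -- radius `2 * ρ` and show that it holds at most half of `Q`.
  refine ⟨(7 * d * 3) ^ d, 1 + (28 * d) ^ d, by positivity, fun Q hQ => ?_⟩
  set N := (7 * d * 3) ^ d with hNdef
  have hN : 0 < N := by positivity
  obtain ⟨o, hoQ, ρ, hρ, hdense, hsparse⟩ := exists_dense_ball Q N hN hQ
  have hhalf : 2 * (Q.filter fun x => dist x o ≤ 2 * ρ).card ≤ Q.card := by
    obtain ⟨T, hTc, hT⟩ := exists_net hd 3 (by norm_num) o ρ hρ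
    have hsub : (Q.filter fun x => dist x o ≤ 2 * ρ) ⊆
        T.biUnion fun z => Q.filter fun x => dist x z ≤ ρ / 3 := by
      intro x hx
      rw [Finset.mem_filter] at hx
      obtain ⟨z, hz, hxz⟩ := hT x (by linarith [hx.2])
      exact Finset.mem_biUnion.mpr ⟨z, hz, Finset.mem_filter.mpr ⟨hx.1, by exact_mod_cast hxz⟩⟩
    have h1 : (Q.filter fun x => dist x o ≤ 2 * ρ).card ≤
        ∑ z ∈ T, (Q.filter fun x => dist x z ≤ ρ / 3).card :=
      (Finset.card_le_card hsub).trans Finset.card_biUnion_le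
    have h2 : 2 * N * ∑ z ∈ T, (Q.filter fun x => dist x z ≤ ρ / 3).card ≤ T.card * Q.card := by
      rw [Finset.mul_sum]
      exact Finset.sum_le_card_nsmul _ _ _ fun z _ => (hsparse z).le
    have h3 : T.card * Q.card ≤ N * Q.card := Nat.mul_le_mul_right _ hTc
    have h4 : N * (2 * (Q.filter fun x => dist x o ≤ 2 * ρ).card) ≤ N * Q.card := by nlinarith
    exact Nat.le_of_mul_le_mul_left h4 hN
  set m : ℝ := (Q.card : ℝ) with hm
  have hm1 : (1 : ℝ) ≤ m := by
    have : 1 ≤ Q.card := by omega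
    rw [hm]
    exact_mod_cast this
  have hd' : (0 : ℝ) < d := by exact_mod_cast hd
  -- The shell has at most `m ^ (1 - α)` points, the net of the order of `m ^ (α * d) = m ^ (1 /
  -- 2)`, which is no larger because `α ≤ 1 / 2`.
  set α : ℝ := 1 / (2 * d) with hα
  have hα0 : 0 < α := by positivity
  have hα1 : α ≤ 1 / 2 := by
    rw [hα, div_le_div_iff₀ (by positivity) (by norm_num)]
    have : (1 : ℝ) ≤ d := by exact_mod_cast hd
    linarith
  have hmα : 1 ≤ m ^ α := Real.one_le_rpow hm1 hα0.le
  set K := ⌈m ^ α⌉₊ with hKdef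
  have hK : 0 < K := Nat.ceil_pos.mpr (by linarith)
  have hKl : m ^ α ≤ K := Nat.le_ceil _
  have hKu : (K : ℝ) ≤ 2 * m ^ α := by
    have := (Nat.ceil_lt_add_one (by linarith : 0 ≤ m ^ α)).le
    linarith
  obtain ⟨t, ht1, ht2, hshell⟩ := exists_thin_shell Q o ρ hρ K hK
  obtain ⟨T, hTc, hT⟩ := exists_net hd (2 * K) (by omega) o ρ hρ
  set w := ρ / (2 * K : ℕ) with hw
  have hw0 : 0 < w := by have : (0 : ℝ) < (2 * K : ℕ) := by exact_mod_cast (by omega : 0 < 2 * K)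
                         positivity
  refine ⟨Q.filter fun x => dist x o ≤ t, Finset.filter_subset _ _,
    (Q.filter fun x => |dist x o - t| < w) ∪ T, ?_, ?_, ?_, ?_⟩
  · refine hdense.trans (Nat.mul_le_mul_left _ (Finset.card_le_card fun x hx => ?_))
    rw [Finset.mem_filter] at hx ⊢
    exact ⟨hx.1, hx.2.trans ht1⟩
  · have h1 : (Q.filter fun x => dist x o ≤ t).card ≤ (Q.filter fun x => dist x o ≤ 2 * ρ).card :=
      Finset.card_le_card fun x hx => by
        rw [Finset.mem_filter] at hx ⊢
        exact ⟨hx.1, hx.2.trans ht2⟩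
    have h2 := Finset.card_sdiff_add_card_eq_card
      (Finset.filter_subset (fun x => dist x o ≤ t) Q)
    nlinarith
  · have hTr : (T.card : ℝ) ≤ ((28 * d : ℕ) : ℝ) ^ d * m ^ (1 - α) := by
      have h1 : (T.card : ℝ) ≤ ((7 * d * (2 * K) : ℕ) : ℝ) ^ d := by exact_mod_cast hTc
      have h2 : ((7 * d * (2 * K) : ℕ) : ℝ) ≤ (28 * d : ℕ) * m ^ α := by
        push_cast
        nlinarith
      have h3 : (m ^ α) ^ d ≤ m ^ (1 - α) := by
        rw [← Real.rpow_mul_natCast (by linarith)]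
        refine Real.rpow_le_rpow_of_exponent_le hm1 ?_
        have : α * d = 1 / 2 := by rw [hα]; field_simp
        linarith
      calc (T.card : ℝ) ≤ ((28 * d : ℕ) * m ^ α) ^ d :=
            h1.trans (pow_le_pow_left₀ (by positivity) h2 d)
        _ = ((28 * d : ℕ) : ℝ) ^ d * (m ^ α) ^ d := mul_pow _ _ _
        _ ≤ _ := by gcongr
    have hSr : ((Q.filter fun x => |dist x o - t| < w).card : ℝ) ≤ m ^ (1 - α) := by
      rw [Real.rpow_sub (by linarith), Real.rpow_one, le_div_iff₀ (by linarith)]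
      have : (K : ℝ) * (Q.filter fun x => |dist x o - t| < w).card ≤ m := by
        rw [hm]
        exact_mod_cast hshell
      have h0 : (0 : ℝ) ≤ (Q.filter fun x => |dist x o - t| < w).card := by positivity
      nlinarith
    have hU : (((Q.filter fun x => |dist x o - t| < w) ∪ T).card : ℝ) ≤
        (Q.filter fun x => |dist x o - t| < w).card + T.card := by
      exact_mod_cast Finset.card_union_le _ _
    refine hU.trans ?_
    push_cast at hTr ⊢
    linarith
  -- If the sphere separates `a` from `x`, the segment between them meets it at some `y`. Unless `a`
  -- itself is in the shell, `y` has distance at least `w` from `a`, so a net point within `w` of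
  -- `y` is no farther from `x` than `a` is.
  · have key : ∀ x, ∀ a ∈ Q, ((dist a o ≤ t ∧ t ≤ dist x o) ∨ (dist x o ≤ t ∧ t ≤ dist a o)) →
        ∃ z ∈ (Q.filter fun x => |dist x o - t| < w) ∪ T, dist x z ≤ dist x a := by
      intro x a ha h
      by_cases hsh : |dist a o - t| < w
      · exact ⟨a, Finset.mem_union_left _ (Finset.mem_filter.mpr ⟨ha, hsh⟩), le_rfl⟩
      · obtain ⟨y, hyo, hy⟩ := exists_dist_eq_between a x o t h
        obtain ⟨z, hz, hyz⟩ := hT y (by linarith)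
        refine ⟨z, Finset.mem_union_right _ hz, ?_⟩
        have h1 : w ≤ dist y a := by
          refine (not_lt.mp hsh).trans ?_
          rw [← hyo, dist_comm y a]
          exact abs_dist_sub_le a y o
        linarith [dist_triangle x y z]
    intro x a ha b hb
    rw [Finset.mem_filter] at ha
    rw [Finset.mem_sdiff, Finset.mem_filter, not_and, not_le] at hb
    rcases le_total t (dist x o) with h | h
    · obtain ⟨z, hz, hxz⟩ := key x a ha.1 (Or.inl ⟨ha.2, h⟩)
      exact ⟨z, hz, hxz.trans (le_max_left _ _)⟩
    · obtain ⟨z, hz, hxz⟩ := key x b hb.1 (Or.inr ⟨h, (hb.2 hb.1).le⟩)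
      exact ⟨z, hz, hxz.trans (le_max_right _ _)⟩

end

/-! ### Recursive division by separators -/

section

/-- Concavity. Scale to `w = 1`: a part `s ≤ 1 / 2` contributes at least `s * 2 ^ (1 - θ)`, and a
part `t ≤ 1` at least `t`. -/
theorem rpow_split_gain {θ c w u v : ℝ} (hθ0 : 0 ≤ θ) (hθ : θ < 1) (hc : 0 < c)
    (hw : 0 < w) (hu : c * w ≤ u) (hv : c * w ≤ v) (huv : w ≤ u + v) (hc1 : c ≤ 1) :
    (1 + c * ((2 : ℝ) ^ (1 - θ) - 1)) * w ^ θ ≤ u ^ θ + v ^ θ := by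
  set g := (2 : ℝ) ^ (1 - θ) with hg
  have hg1 : 1 ≤ g := Real.one_le_rpow (by norm_num) (by linarith)
  have hg2 : g ≤ 2 := by
    calc g ≤ (2 : ℝ) ^ (1 : ℝ) := Real.rpow_le_rpow_of_exponent_le (by norm_num) (by linarith)
      _ = 2 := by simp
  have hle : ∀ s : ℝ, 0 < s → s ≤ 1 → s ≤ s ^ θ := fun s h0 h1 => by
    calc s = s ^ (1 : ℝ) := (Real.rpow_one s).symm
      _ ≤ s ^ θ := Real.rpow_le_rpow_of_exponent_ge h0 h1 hθ.le
  have hhalf : ∀ s : ℝ, 0 < s → s ≤ 1 / 2 → s * g ≤ s ^ θ := fun s h0 h1 => by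
    have h2 : g ≤ s ^ (θ - 1) := by
      have : g = (1 / 2 : ℝ) ^ (θ - 1) := by
        rw [hg, one_div, Real.inv_rpow (by norm_num), ← Real.rpow_neg (by norm_num)]
        congr 1; ring
      rw [this]
      exact Real.rpow_le_rpow_of_nonpos h0 h1 (by linarith)
    calc s * g ≤ s * s ^ (θ - 1) := by gcongr
      _ = s ^ θ := by
        rw [Real.rpow_sub_one h0.ne']; field_simp
  have norm : ∀ s t : ℝ, c ≤ s → c ≤ t → 1 ≤ s + t → 1 + c * (g - 1) ≤ s ^ θ + t ^ θ := by
    intro s t hs ht hst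
    have hs0 : 0 < s := hc.trans_le hs
    have ht0 : 0 < t := hc.trans_le ht
    have hcs : c ≤ s ^ θ := by
      rcases le_total s 1 with h | h
      · exact hs.trans (hle s hs0 h)
      · exact hc1.trans (Real.one_le_rpow h hθ0)
    have hct : c ≤ t ^ θ := by
      rcases le_total t 1 with h | h
      · exact ht.trans (hle t ht0 h)
      · exact hc1.trans (Real.one_le_rpow h hθ0)
    rcases le_total 1 s with h1 | h1
    · have := Real.one_le_rpow h1 hθ0
      nlinarith
    rcases le_total 1 t with h2 | h2
    · have := Real.one_le_rpow h2 hθ0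
      nlinarith
    rcases le_total s (1 / 2) with h3 | h3
    · have := hhalf s hs0 h3
      have := hle t ht0 h2
      nlinarith
    rcases le_total t (1 / 2) with h4 | h4
    · have := hhalf t ht0 h4
      have := hle s hs0 h1
      nlinarith
    · have e := hhalf (1 / 2) (by norm_num) le_rfl
      have e1 : (1 / 2 : ℝ) ^ θ ≤ s ^ θ := Real.rpow_le_rpow (by norm_num) h3 hθ0
      have e2 : (1 / 2 : ℝ) ^ θ ≤ t ^ θ := Real.rpow_le_rpow (by norm_num) h4 hθ0
      nlinarith
  have h := norm (u / w) (v / w) ((le_div_iff₀ hw).mpr hu) ((le_div_iff₀ hw).mpr hv)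
    (by rw [← add_div, le_div_iff₀ hw]; linarith)
  have hu0 : 0 ≤ u := (by positivity : 0 ≤ c * w).trans hu
  have hv0 : 0 ≤ v := (by positivity : 0 ≤ c * w).trans hv
  rw [Real.div_rpow hu0 hw.le, Real.div_rpow hv0 hw.le, ← add_div,
    le_div_iff₀ (Real.rpow_pos_of_pos hw θ)] at h
  exact h

/-- The potential `(1 + η) * w - D * w ^ θ` pays for a separator of `C * s` points copied into both
parts, where `s = w ^ θ`: the copies cost at most `4 * C * s`, and concavity gains `D * g * s`. -/
theorem division_potential_step {η C D g w s a b p q S T : ℝ} (hη0 : 0 ≤ η)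
    (hη : η ≤ 1) (hC : 0 ≤ C) (hD0 : 0 ≤ D) (hs : 0 ≤ s) (hD : D * g = 4 * C)
    (hsum : a + b ≤ w + 2 * (C * s)) (hgain : (1 + g) * s ≤ p + q)
    (hS : S ≤ (1 + η) * a - D * p) (hT : T ≤ (1 + η) * b - D * q) :
    S + T ≤ (1 + η) * w - D * s := by
  have k3 := mul_le_mul_of_nonneg_left hgain hD0
  have k4 : D * ((1 + g) * s) = D * s + 4 * C * s := by rw [← hD]; ring
  have k5 : (1 + η) * (a + b) ≤ (1 + η) * (w + 2 * (C * s)) := by gcongr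
  have k6 : 0 ≤ (1 - η) * (C * s) := mul_nonneg (by linarith) (by positivity)
  nlinarith

open Classical in
/-- The points of `P` that carry the label `i`. -/
noncomputable def labelClass {X ι : Type*} (P : Finset X) (lab : X → ι) (i : ι) : Finset X :=
  P.filter fun x => lab x = i

theorem mem_labelClass {X ι : Type*} {P : Finset X} {lab : X → ι} {i : ι} {x : X} :
    x ∈ labelClass P lab i ↔ x ∈ P ∧ lab x = i := by
  classical
  simp [labelClass]

theorem labelClass_subset {X ι : Type*} {P : Finset X} {lab : X → ι} {i : ι} :
    labelClass P lab i ⊆ P := fun _ hx => (mem_labelClass.mp hx).1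

set_option maxHeartbeats 1000000 in
open Classical in
/-- Recursive separation of `P` into regions, where the points of `Z₀` are an outer boundary. -/
theorem exists_division_of_separator {X : Type*} [MetricSpace X] (N : ℕ)
    (C θ η r : ℝ) (hN : 0 < N) (hC : 0 < C) (hθ0 : 0 ≤ θ) (hθ1 : θ < 1)
    (hsep : ∀ Q : Finset X, 2 * N < Q.card →
      ∃ A ⊆ Q, ∃ Z : Finset X,
        Q.card ≤ 2 * N * A.card ∧ Q.card ≤ 2 * N * (Q \ A).card ∧
        (Z.card : ℝ) ≤ C * (Q.card : ℝ) ^ θ ∧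
        ∀ x, ∀ a ∈ A, ∀ b ∈ Q \ A, ∃ z ∈ Z, dist x z ≤ max (dist x a) (dist x b))
    (hη0 : 0 ≤ η) (hη : η ≤ 1) (hr1 : 4 * N ≤ r) (hr2 : 2 * N * C ≤ (r / 2) ^ (1 - θ)) (D : ℝ) (hD0 : 0 ≤ D)
    (hD : D * (1 / (4 * N) * ((2 : ℝ) ^ (1 - θ) - 1)) = 4 * C)
    (hr3 : D ≤ η * (1 / (4 * N) * r) ^ (1 - θ)) :
    ∀ (w : ℕ) (P Z₀ : Finset X), P.card + Z₀.card = w →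
      ∃ (ι : Type) (_ : Fintype ι) (lab : X → ι) (Z : ι → Finset X),
        (∀ i, (((labelClass P lab i).card + (Z i).card : ℕ) : ℝ) ≤ r) ∧
        (1 / (4 * N) * r ≤ w →
          ((∑ i, ((labelClass P lab i).card + (Z i).card) : ℕ) : ℝ) ≤
            (1 + η) * w - D * (w : ℝ) ^ θ) ∧
        (∀ x, ∀ a ∈ P, ∀ b ∈ P, lab a ≠ lab b →
          ∃ z ∈ Z (lab a), dist x z ≤ max (dist x a) (dist x b)) ∧
        (∀ x, ∀ a ∈ P, ∀ b ∈ Z₀, ∃ z ∈ Z (lab a), dist x z ≤ max (dist x a) (dist x b)) ∧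
        ((w : ℝ) ≤ r → ∀ i, Z i = Z₀) := by
  have hN' : (0 : ℝ) < N := by exact_mod_cast hN
  have hr0 : 0 < r := by linarith
  intro w
  induction w using Nat.strong_induction_on with
  | _ w ih =>
  intro P Z₀ hw
  by_cases hwr : (w : ℝ) ≤ r
  · refine ⟨Unit, inferInstance, fun _ => (), fun _ => Z₀, ?_, ?_, ?_, ?_, ?_⟩
    · intro i
      simpa [labelClass, hw] using hwr
    · intro hcw
      have hw0 : (0 : ℝ) < w := lt_of_lt_of_le (by positivity) hcw
      -- The lower bound on `w` serves here: a leaf that is not too small has enough slack `η * w`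
      -- for the potential term.
      have h1 : D * (w : ℝ) ^ θ ≤ η * w := by
        have h2 : (1 / (4 * N) * r) ^ (1 - θ) ≤ (w : ℝ) ^ (1 - θ) :=
          Real.rpow_le_rpow (by positivity) hcw (by linarith)
        calc D * (w : ℝ) ^ θ ≤ (η * (w : ℝ) ^ (1 - θ)) * (w : ℝ) ^ θ := by
              gcongr
              exact hr3.trans (by gcongr)
          _ = η * w := by
              rw [mul_assoc, ← Real.rpow_add hw0]
              simp
      simp [labelClass, hw]
      linarith
    · intro x a _ b _ h
      exact absurd rfl h
    · intro x a _ b hb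
      exact ⟨b, hb, le_max_right _ _⟩
    · intro _ _
      rfl
  · push Not at hwr
    -- The old boundary is separated along with `P`: each part keeps the old boundary points on its
    -- own side and gets the new separator in place of the others.
    set Q := P ∪ Z₀ with hQ
    have hQw : Q.card ≤ w := (Finset.card_union_le _ _).trans hw.le
    have hwQ : w ≤ 2 * Q.card := by
      have h1 : P.card ≤ Q.card := Finset.card_le_card Finset.subset_union_left
      have h2 : Z₀.card ≤ Q.card := Finset.card_le_card Finset.subset_union_right
      omega
    have hQwr : (Q.card : ℝ) ≤ w := by exact_mod_cast hQw
    have hwQr : (w : ℝ) ≤ 2 * Q.card := by exact_mod_cast hwQ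
    have hQr : r / 2 < Q.card := by linarith
    have hQ0 : (0 : ℝ) < Q.card := by linarith
    have hw0 : (0 : ℝ) < w := by linarith
    have hQN : 2 * N < Q.card := by
      have : (2 * N : ℝ) < Q.card := by linarith
      exact_mod_cast this
    obtain ⟨A, hAQ, Z, hA, hB, hZ, hball⟩ := hsep Q hQN
    have hZw : (Z.card : ℝ) ≤ C * (w : ℝ) ^ θ := hZ.trans (by gcongr)
    have hZlt : (2 * N : ℝ) * Z.card < Q.card := by
      have h1 : 2 * N * C < (Q.card : ℝ) ^ (1 - θ) :=
        hr2.trans_lt (Real.rpow_lt_rpow (by positivity) hQr (by linarith))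
      calc (2 * N : ℝ) * Z.card ≤ 2 * N * (C * (Q.card : ℝ) ^ θ) := by gcongr
        _ = (2 * N * C) * (Q.card : ℝ) ^ θ := by ring
        _ < (Q.card : ℝ) ^ (1 - θ) * (Q.card : ℝ) ^ θ := by gcongr
        _ = Q.card := by rw [← Real.rpow_add hQ0]; simp
    have hZlt' : 2 * N * Z.card < Q.card := by exact_mod_cast hZlt
    -- Each part gains a copy of `Z` and loses the other side, so its weight drops strictly and the
    -- induction applies.
    have hZA : Z.card < A.card := by
      by_contra hcon
      push Not at hcon
      have := Nat.mul_le_mul_left (2 * N) hcon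
      omega
    have hZB : Z.card < (Q \ A).card := by
      by_contra hcon
      push Not at hcon
      have := Nat.mul_le_mul_left (2 * N) hcon
      omega
    set PA := P.filter (· ∈ A) with hPA
    set PB := P.filter (· ∉ A) with hPB
    set ZA := Z₀.filter (· ∈ A) with hZA'
    set ZB := Z₀.filter (· ∉ A) with hZB'
    have cP : PA.card + PB.card = P.card := Finset.card_filter_add_card_filter_not _
    have cZ : ZA.card + ZB.card = Z₀.card := Finset.card_filter_add_card_filter_not _
    have cA : A.card ≤ PA.card + ZA.card := by
      refine le_trans (Finset.card_le_card fun x hx => ?_) (Finset.card_union_le PA ZA)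
      have := hAQ hx
      simp only [hQ, Finset.mem_union] at this
      simp only [hPA, hZA', Finset.mem_union, Finset.mem_filter]
      tauto
    have cB : (Q \ A).card ≤ PB.card + ZB.card := by
      refine le_trans (Finset.card_le_card fun x hx => ?_) (Finset.card_union_le PB ZB)
      simp only [hQ, Finset.mem_union, Finset.mem_sdiff] at hx
      simp only [hPB, hZB', Finset.mem_union, Finset.mem_filter]
      tauto
    have uA : (ZA ∪ Z).card ≤ ZA.card + Z.card := Finset.card_union_le _ _
    have uB : (ZB ∪ Z).card ≤ ZB.card + Z.card := Finset.card_union_le _ _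
    have lA : ZA.card ≤ (ZA ∪ Z).card := Finset.card_le_card Finset.subset_union_left
    have lB : ZB.card ≤ (ZB ∪ Z).card := Finset.card_le_card Finset.subset_union_left
    obtain ⟨ι₁, f₁, lab₁, Z₁, h11, h12, h13, h14, -⟩ :=
      ih (PA.card + (ZA ∪ Z).card) (by omega) PA (ZA ∪ Z) rfl
    obtain ⟨ι₂, f₂, lab₂, Z₂, h21, h22, h23, h24, -⟩ :=
      ih (PB.card + (ZB ∪ Z).card) (by omega) PB (ZB ∪ Z) rfl
    let lab : X → ι₁ ⊕ ι₂ := fun x => if x ∈ A then Sum.inl (lab₁ x) else Sum.inr (lab₂ x)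
    have e1 : ∀ i, labelClass P lab (Sum.inl i) = labelClass PA lab₁ i := by
      intro i
      ext x
      by_cases hx : x ∈ A <;> simp [labelClass, lab, hPA, hx]
    have e2 : ∀ i, labelClass P lab (Sum.inr i) = labelClass PB lab₂ i := by
      intro i
      ext x
      by_cases hx : x ∈ A <;> simp [labelClass, lab, hPB, hx]
    refine ⟨ι₁ ⊕ ι₂, inferInstance, lab, Sum.elim Z₁ Z₂, ?_, ?_, ?_, ?_, ?_⟩
    · rintro (i | i)
      · rw [e1]; exact h11 i
      · rw [e2]; exact h21 i
    · intro _
      rw [Fintype.sum_sum_type]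
      simp only [e1, e2, Sum.elim_inl, Sum.elim_inr]
      set wA := PA.card + (ZA ∪ Z).card with hwA
      set wB := PB.card + (ZB ∪ Z).card with hwB
      have wAl : 1 / (4 * N) * (w : ℝ) ≤ wA := by
        have h1 : A.card ≤ wA := by omega
        have h2 : w ≤ 4 * N * wA := by nlinarith
        have h3 : (w : ℝ) ≤ 4 * N * wA := by exact_mod_cast h2
        rw [one_div, inv_mul_le_iff₀ (by positivity)]
        exact h3
      have wBl : 1 / (4 * N) * (w : ℝ) ≤ wB := by
        have h1 : (Q \ A).card ≤ wB := by omega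
        have h2 : w ≤ 4 * N * wB := by nlinarith
        have h3 : (w : ℝ) ≤ 4 * N * wB := by exact_mod_cast h2
        rw [one_div, inv_mul_le_iff₀ (by positivity)]
        exact h3
      have hrw : 1 / (4 * N) * r ≤ 1 / (4 * N) * (w : ℝ) := by gcongr
      have k1 := h12 (hrw.trans wAl)
      have k2 := h22 (hrw.trans wBl)
      have hsum : (wA : ℝ) + wB ≤ w + 2 * (C * (w : ℝ) ^ θ) := by
        have : wA + wB ≤ w + 2 * Z.card := by omega
        have : (wA : ℝ) + wB ≤ w + 2 * Z.card := by exact_mod_cast this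
        linarith
      have hsum' : (w : ℝ) ≤ wA + wB := by
        have : w ≤ wA + wB := by omega
        exact_mod_cast this
      have hgain := rpow_split_gain hθ0 hθ1 (by positivity) hw0 wAl wBl hsum' (by
        rw [one_div]
        apply inv_le_one_of_one_le₀
        have : (1 : ℝ) ≤ N := by exact_mod_cast hN
        linarith)
      have hwθ : 0 ≤ (w : ℝ) ^ θ := by positivity
      push_cast at k1 k2 ⊢
      exact division_potential_step hη0 hη hC.le hD0 hwθ hD hsum hgain k1 k2
    · intro x a ha b hb hab
      by_cases hxa : a ∈ A <;> by_cases hxb : b ∈ A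
      · simp only [lab, hxa, hxb, if_true, ne_eq, Sum.inl.injEq] at hab
        simp only [lab, hxa, if_true, Sum.elim_inl]
        exact h13 x a (by simp [hPA, ha, hxa]) b (by simp [hPA, hb, hxb]) hab
      -- A point `z` of the separator stands in for `b`. It is an outer boundary point for the part
      -- of `a`, and induction trades it for one of the region of `a`.
      · obtain ⟨z, hz, hxz⟩ := hball x a hxa b (by simp [hQ, hb, hxb])
        simp only [lab, hxa, if_true, Sum.elim_inl]
        obtain ⟨z', hz', hxz'⟩ := h14 x a (by simp [hPA, ha, hxa]) z (by simp [hz])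
        exact ⟨z', hz', hxz'.trans (max_le (le_max_left _ _) hxz)⟩
      · obtain ⟨z, hz, hxz⟩ := hball x b hxb a (by simp [hQ, ha, hxa])
        simp only [lab, hxa, if_false, Sum.elim_inr]
        obtain ⟨z', hz', hxz'⟩ := h24 x a (by simp [hPB, ha, hxa]) z (by simp [hz])
        exact ⟨z', hz', hxz'.trans (max_le (le_max_left _ _) (hxz.trans (max_comm _ _).le))⟩
      · simp only [lab, hxa, hxb, if_false, ne_eq, Sum.inr.injEq] at hab
        simp only [lab, hxa, if_false, Sum.elim_inr]
        exact h23 x a (by simp [hPB, ha, hxa]) b (by simp [hPB, hb, hxb]) hab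
    · intro x a ha b hb
      by_cases hxa : a ∈ A <;> by_cases hxb : b ∈ A
      · simp only [lab, hxa, if_true, Sum.elim_inl]
        exact h14 x a (by simp [hPA, ha, hxa]) b (by simp [hZA', hb, hxb])
      · obtain ⟨z, hz, hxz⟩ := hball x a hxa b (by simp [hQ, hb, hxb])
        simp only [lab, hxa, if_true, Sum.elim_inl]
        obtain ⟨z', hz', hxz'⟩ := h14 x a (by simp [hPA, ha, hxa]) z (by simp [hz])
        exact ⟨z', hz', hxz'.trans (max_le (le_max_left _ _) hxz)⟩
      · obtain ⟨z, hz, hxz⟩ := hball x b hxb a (by simp [hQ, ha, hxa])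
        simp only [lab, hxa, if_false, Sum.elim_inr]
        obtain ⟨z', hz', hxz'⟩ := h24 x a (by simp [hPB, ha, hxa]) z (by simp [hz])
        exact ⟨z', hz', hxz'.trans (max_le (le_max_left _ _) (hxz.trans (max_comm _ _).le))⟩
      · simp only [lab, hxa, if_false, Sum.elim_inr]
        exact h24 x a (by simp [hPB, ha, hxa]) b (by simp [hZB', hb, hxb])
    · intro h
      exact absurd h (not_le.mpr hwr)

end

/-! ### Divisions in Euclidean space -/

section

/-- Every finite point set in Euclidean space has a division into regions of size polynomial in
`1 / η`, with a total boundary of at most an `η` fraction of the points, such that each ball meeting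
two regions contains boundary points of both. -/
theorem exists_division {d : ℕ} (hd : 0 < d) :
    ∃ A : ℕ, ∀ η : ℝ, 0 < η → η ≤ 1 → ∀ P : Finset (EuclideanSpace ℝ (Fin d)),
      ∃ (ι : Type) (_ : Fintype ι) (lab : EuclideanSpace ℝ (Fin d) → ι)
        (Z : ι → Finset (EuclideanSpace ℝ (Fin d))),
        (∀ i, (((labelClass P lab i).card + (Z i).card : ℕ) : ℝ) ≤ A * (1 / η) ^ (2 * d)) ∧
        ((∑ i, (Z i).card : ℕ) : ℝ) ≤ η * P.card ∧
        ∀ x, ∀ a ∈ P, ∀ b ∈ P, lab a ≠ lab b →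
          ∃ z ∈ Z (lab a), dist x z ≤ max (dist x a) (dist x b) := by
  obtain ⟨N, C, hN, hsep⟩ := exists_separator hd
  have hN' : (0 : ℝ) < N := by exact_mod_cast hN
  have hd1 : (1 : ℝ) ≤ d := by exact_mod_cast hd
  set θ : ℝ := 1 - 1 / (2 * d) with hθ
  have hθe : 1 - θ = 1 / (2 * d) := by rw [hθ]; ring
  have hθ1 : θ < 1 := by
    have : (0 : ℝ) < 1 / (2 * d) := by positivity
    linarith
  have hθ0 : 0 ≤ θ := by
    have : 1 / (2 * (d : ℝ)) ≤ 1 := by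
      rw [div_le_one (by positivity)]; linarith
    linarith
  have hroot : ∀ a b : ℝ, 0 ≤ a → a ^ (2 * d) ≤ b → a ≤ b ^ (1 - θ) := by
    intro a b ha hab
    have hne : (2 * d : ℕ) ≠ 0 := by omega
    calc a = (a ^ (2 * d)) ^ (((2 * d : ℕ) : ℝ)⁻¹) := (Real.pow_rpow_inv_natCast ha hne).symm
      _ ≤ b ^ (((2 * d : ℕ) : ℝ)⁻¹) := Real.rpow_le_rpow (by positivity) hab (by positivity)
      _ = b ^ (1 - θ) := by rw [hθe]; push_cast; rw [one_div]
  set C' : ℝ := C + 1 with hC'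
  have hC0 : 0 < C' := by positivity
  have hg : 0 < (2 : ℝ) ^ (1 - θ) - 1 := by
    have : (1 : ℝ) < (2 : ℝ) ^ (1 - θ) := Real.one_lt_rpow (by norm_num) (by linarith)
    linarith
  have hg' : 0 < 1 / (4 * (N : ℝ)) * ((2 : ℝ) ^ (1 - θ) - 1) := mul_pos (by positivity) hg
  set D : ℝ := 4 * C' / (1 / (4 * N) * ((2 : ℝ) ^ (1 - θ) - 1)) with hD
  have hD0 : 0 ≤ D := by positivity
  -- One summand for each of `hr1`, `hr2`, `hr3`. As `1 - θ = 1 / (2 * d)`, inverting these bounds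
  -- gives powers `2 * d`.
  set B : ℝ := 4 * N + 2 * (2 * N * C') ^ (2 * d) + 4 * N * D ^ (2 * d) with hB
  refine ⟨⌈B⌉₊, fun η hη hη1 P => ?_⟩
  set r : ℝ := ⌈B⌉₊ * (1 / η) ^ (2 * d) with hr
  have hBl : B ≤ ⌈B⌉₊ := Nat.le_ceil B
  have hη2 : 1 ≤ (1 / η) ^ (2 * d) := one_le_pow₀ ((one_le_div hη).mpr hη1)
  have hBr : B * (1 / η) ^ (2 * d) ≤ r := by rw [hr]; gcongr
  have t1 : 0 ≤ 2 * (2 * N * C') ^ (2 * d) := by positivity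
  have t2 : 0 ≤ 4 * N * D ^ (2 * d) := by positivity
  have hBr' : B ≤ r := by nlinarith
  have hr1 : 4 * (N : ℝ) ≤ r := by linarith
  have hr2 : 2 * N * C' ≤ (r / 2) ^ (1 - θ) := hroot _ _ (by positivity) (by linarith)
  have hr3 : D ≤ η * (1 / (4 * N) * r) ^ (1 - θ) := by
    have h : D / η ≤ (1 / (4 * N) * r) ^ (1 - θ) := by
      refine hroot _ _ (by positivity) ?_
      rw [one_div, ← div_eq_inv_mul, le_div_iff₀ (by positivity), div_pow]
      calc D ^ (2 * d) / η ^ (2 * d) * (4 * N) = 4 * N * D ^ (2 * d) * (1 / η) ^ (2 * d) := by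
            rw [one_div, inv_pow]; field_simp
        _ ≤ B * (1 / η) ^ (2 * d) := by
            gcongr
            linarith
        _ ≤ r := hBr
    rw [div_le_iff₀ hη] at h
    linarith
  obtain ⟨ι, hι, lab, Z, h1, h2, h3, -, h5⟩ :=
    exists_division_of_separator (X := EuclideanSpace ℝ (Fin d)) N C' θ η r hN hC0 hθ0 hθ1
      (fun Q hQ => by
        obtain ⟨A, hA, Z, hZ1, hZ2, hZ3, hZ4⟩ := hsep Q hQ
        refine ⟨A, hA, Z, hZ1, by convert hZ2, hZ3.trans ?_, fun x a ha b hb =>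
          hZ4 x a ha b (by simpa only [Finset.mem_sdiff] using hb)⟩
        gcongr
        linarith)
      hη.le hη1 hr1 hr2 D hD0 (div_mul_cancel₀ _ hg'.ne') hr3 (P.card) P ∅ (by simp)
  refine ⟨ι, hι, lab, Z, h1, ?_, h3⟩
  -- A small `P` may fall short of the range of the size bound, but then the boundary is still the
  -- initial `∅`.
  by_cases hPr : (P.card : ℝ) ≤ r
  · have : ∑ i, (Z i).card = 0 := by simp [h5 hPr]
    rw [this]
    push_cast
    positivity
  · push Not at hPr
    have h6 := h2 (by
      have : 1 / (4 * (N : ℝ)) ≤ 1 := by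
        rw [div_le_one (by positivity)]
        have : (1 : ℝ) ≤ N := by exact_mod_cast hN
        linarith
      nlinarith)
    have h7 : ∑ i, (labelClass P lab i).card = P.card := by
      classical
      rw [Finset.card_eq_sum_card_fiberwise (f := lab) (t := Finset.univ) (fun _ _ => by simp)]
      rfl
    rw [Finset.sum_add_distrib, h7] at h6
    push_cast at h6 ⊢
    have h8 : 0 ≤ D * (P.card : ℝ) ^ θ := by positivity
    linarith

end

/-! ### Independent sets, balanced groupings and a power inequality -/

section

open Classical in
/-- A function without fixed points has a large independent set. -/
theorem exists_independent {α : Type*} (φ : α → α) (F : Finset α) (hφ : ∀ f ∈ F, φ f ≠ f) :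
    ∃ A ⊆ F, F.card ≤ 3 * A.card ∧ ∀ a ∈ A, φ a ∉ A := by
  induction hn : F.card using Nat.strong_induction_on generalizing F with
  | _ n ih =>
  rcases F.eq_empty_or_nonempty with rfl | hF
  · exact ⟨∅, le_rfl, by simp at hn; omega, by simp⟩
  have hsum : ∑ f ∈ F, (F.filter fun a => φ a = f).card ≤ F.card := by
    rw [← Finset.card_biUnion]
    · exact Finset.card_le_card (Finset.biUnion_subset.mpr fun _ _ => Finset.filter_subset _ _)
    · intro f _ g _ hfg
      refine Finset.disjoint_left.mpr fun x hx hx' => hfg ?_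
      rw [← (Finset.mem_filter.mp hx).2, ← (Finset.mem_filter.mp hx').2]
  -- On average a point has at most one preimage. Choosing an `f` with at most one excludes only
  -- `f`, `φ f` and that preimage.
  obtain ⟨f, hf, hf1⟩ := Finset.exists_le_of_sum_le (s := F)
    (f := fun f => (F.filter fun a => φ a = f).card) (g := fun _ => 1) hF (by simpa using hsum)
  set W := insert f (insert (φ f) (F.filter fun a => φ a = f)) with hW
  have hWc : W.card ≤ 3 := by
    have h1 := Finset.card_insert_le f (insert (φ f) (F.filter fun a => φ a = f))
    have h2 := Finset.card_insert_le (φ f) (F.filter fun a => φ a = f)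
    rw [hW]
    omega
  have hlt : (F \ W).card < n := by
    rw [← hn]
    exact Finset.card_lt_card (Finset.ssubset_iff_subset_ne.mpr ⟨Finset.sdiff_subset, fun h => by
      have : f ∈ F \ W := by rw [h]; exact hf
      simp [hW] at this⟩)
  obtain ⟨A, hA, hAc, hind⟩ := ih _ hlt (F \ W)
    (fun g hg => hφ g (Finset.mem_sdiff.mp hg).1) rfl
  have hfA : f ∉ A := fun h => by
    have := (Finset.mem_sdiff.mp (hA h)).2
    simp [hW] at this
  refine ⟨insert f A, Finset.insert_subset hf (hA.trans Finset.sdiff_subset), ?_, ?_⟩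
  · rw [Finset.card_insert_of_notMem hfA]
    have := Finset.le_card_sdiff W F
    omega
  · intro a ha hcon
    rw [Finset.mem_insert] at ha hcon
    rcases ha with rfl | ha
    · rcases hcon with h | h
      · exact hφ a hf h
      · have := (Finset.mem_sdiff.mp (hA h)).2
        simp [hW] at this
    · have haF := Finset.mem_sdiff.mp (hA ha)
      rcases hcon with h | h
      · exact haF.2 (by simp [hW, haF.1, h])
      · exact hind a ha h

/-- The `t` cheapest elements of `N` carry at most their share of the total weight. -/
theorem exists_cheap_subset {α : Type*} (N : Finset α) (w : α → ℝ) (t : ℕ)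
    (ht : t ≤ N.card) :
    ∃ T ⊆ N, T.card = t ∧ (∑ a ∈ T, w a) * N.card ≤ t * ∑ a ∈ N, w a := by
  classical
  induction hn : N.card generalizing N with
  | zero =>
    refine ⟨∅, by simp, by simp; omega, ?_⟩
    have : t = 0 := by omega
    simp [this]
  | succ n ih =>
    rcases Nat.lt_or_ge n t with h | h
    · refine ⟨N, le_rfl, by omega, ?_⟩
      have : t = n + 1 := by omega
      rw [this, mul_comm]
    · obtain ⟨a, ha, hmax⟩ := N.exists_max_image w (Finset.card_pos.mp (by omega))
      have hc : (N.erase a).card = n := by rw [Finset.card_erase_of_mem ha]; omega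
      obtain ⟨T, hT, hTt, hTw⟩ := ih (N.erase a) (by omega) hc
      refine ⟨T, hT.trans (Finset.erase_subset _ _), hTt, ?_⟩
      have hsplit := Finset.add_sum_erase N w ha
      have hle : ∑ b ∈ N.erase a, w b ≤ n * w a := by
        rw [← hc, ← nsmul_eq_mul]
        exact Finset.sum_le_card_nsmul _ _ _ fun b hb => hmax b (Finset.mem_of_mem_erase hb)
      have hTle : ∑ b ∈ T, w b ≤ t * w a := by
        rw [← hTt, ← nsmul_eq_mul]
        exact Finset.sum_le_card_nsmul _ _ _ fun b hb => hmax b (Finset.mem_of_mem_erase (hT hb))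
      push_cast
      rw [← hsplit]
      nlinarith

/-- Positive entries are lowered by one until the surplus is gone, which never leaves `[-r, r]`.
Exact zero sums are what the pigeonhole argument for groupings needs. -/
theorem exists_sum_eq_zero_of_sum_nonneg {α : Type*} (I : Finset α) (a : α → ℤ) (r : ℤ)
    (ha : ∀ i ∈ I, |a i| ≤ r) (hsum : 0 ≤ ∑ i ∈ I, a i) :
    ∃ b : α → ℤ, (∀ i, b i ≤ a i) ∧ (∀ i ∈ I, |b i| ≤ r) ∧ ∑ i ∈ I, b i = 0 := by
  classical
  obtain ⟨n, hn⟩ := Int.eq_ofNat_of_zero_le hsum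
  induction n generalizing a with
  | zero => exact ⟨a, fun _ => le_rfl, ha, by simpa using hn⟩
  | succ n ih =>
    obtain ⟨i, hi, hpos⟩ : ∃ i ∈ I, 0 < a i := by
      by_contra hcon
      push Not at hcon
      have := Finset.sum_nonpos hcon
      omega
    have hup : ∑ j ∈ I, Function.update a i (a i - 1) j = n := by
      rw [Finset.sum_update_of_mem hi]
      have := Finset.add_sum_erase I a hi
      rw [Finset.sdiff_singleton_eq_erase]
      push_cast at hn
      linarith
    obtain ⟨b, hb1, hb2, hb3⟩ := ih (Function.update a i (a i - 1)) (by
      intro j hj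
      by_cases hji : j = i
      · subst hji
        have := abs_le.mp (ha j hj)
        rw [Function.update_self, abs_le]
        omega
      · rw [Function.update_of_ne hji]
        exact ha j hj) (by omega) hup
    refine ⟨b, fun j => (hb1 j).trans ?_, hb2, hb3⟩
    by_cases hji : j = i
    · subst hji; simp
    · rw [Function.update_of_ne hji]

/-- A chain of subsets of a zero-sum family whose partial sums stay bounded. -/
theorem exists_bounded_chain {α : Type*} [DecidableEq α] (I : Finset α) (a : α → ℤ) (r : ℤ)
    (hr : 0 ≤ r) (ha : ∀ i ∈ I, |a i| ≤ r) (hsum : ∑ i ∈ I, a i = 0) :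
    ∃ J : ℕ → Finset α, Monotone J ∧ (∀ n, J n ⊆ I) ∧ (∀ n ≤ I.card, (J n).card = n) ∧
      ∀ n, |∑ i ∈ J n, a i| ≤ r := by
  have step : ∀ S : Finset α, S ⊆ I ∧ |∑ i ∈ S, a i| ≤ r → ∃ T : Finset α,
      S ⊆ T ∧ (T ⊆ I ∧ |∑ i ∈ T, a i| ≤ r) ∧ (S ≠ I → T.card = S.card + 1) := by
    rintro S ⟨hSI, hS⟩
    by_cases hSI' : S = I
    · exact ⟨S, le_rfl, ⟨hSI, hS⟩, fun h => absurd hSI' h⟩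
    have hrest : ∑ i ∈ I \ S, a i + ∑ i ∈ S, a i = 0 := by
      rw [Finset.sum_sdiff hSI, hsum]
    have hne : (I \ S).Nonempty :=
      Finset.sdiff_nonempty.mpr fun h => hSI' (Finset.Subset.antisymm hSI h)
    have hS' := abs_le.mp hS
    have : ∃ i ∈ I \ S, |∑ j ∈ S, a j + a i| ≤ r := by
      -- The remaining items sum to the negative of the partial sum, so one of them pulls it back
      -- towards zero.
      rcases lt_or_ge 0 (∑ i ∈ S, a i) with h | h
      · obtain ⟨i, hi, hneg⟩ : ∃ i ∈ I \ S, a i < 0 := by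
          by_contra hcon
          push Not at hcon
          have := Finset.sum_nonneg hcon
          omega
        have := abs_le.mp (ha i (Finset.mem_sdiff.mp hi).1)
        exact ⟨i, hi, abs_le.mpr ⟨by omega, by omega⟩⟩
      · obtain ⟨i, hi, hnn⟩ : ∃ i ∈ I \ S, 0 ≤ a i := by
          by_contra hcon
          push Not at hcon
          have := Finset.sum_neg hcon hne
          omega
        have := abs_le.mp (ha i (Finset.mem_sdiff.mp hi).1)
        exact ⟨i, hi, abs_le.mpr ⟨by omega, by omega⟩⟩
    obtain ⟨i, hi, hle⟩ := this
    have hi' := Finset.mem_sdiff.mp hi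
    refine ⟨insert i S, Finset.subset_insert _ _, ⟨Finset.insert_subset hi'.1 hSI, ?_⟩, fun _ =>
      Finset.card_insert_of_notMem hi'.2⟩
    rw [Finset.sum_insert hi'.2, add_comm]
    exact hle
  choose! next h1 h2 h3 using step
  let J : ℕ → Finset α := fun n => next^[n] ∅
  have hJs : ∀ n, J (n + 1) = next (J n) := fun n => Function.iterate_succ_apply' _ _ _
  have hinv : ∀ n, J n ⊆ I ∧ |∑ i ∈ J n, a i| ≤ r := by
    intro n
    induction n with
    | zero => simpa [J] using hr
    | succ n ih => rw [hJs]; exact h2 _ ih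
  refine ⟨J, monotone_nat_of_le_succ fun n => by rw [hJs]; exact h1 _ (hinv n),
    fun n => (hinv n).1, ?_, fun n => (hinv n).2⟩
  intro n
  induction n with
  | zero => intro _; simp [J]
  | succ n ih =>
    intro hn
    have hc := ih (by omega)
    rw [hJs, h3 _ (hinv n) (fun h => by rw [h] at hc; omega), hc]

/-- A zero-sum subfamily of controlled size. -/
theorem exists_zero_sum_subset {α : Type*} [DecidableEq α] (I : Finset α) (a : α → ℤ) (r q : ℕ)
    (ha : ∀ i ∈ I, |a i| ≤ r) (hsum : ∑ i ∈ I, a i = 0) (hI : (2 * r + 1) * q ≤ I.card) :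
    ∃ J ⊆ I, q ≤ J.card ∧ J.card ≤ (2 * r + 1) * q ∧ ∑ i ∈ J, a i = 0 := by
  obtain ⟨J, hmono, hJI, hJc, hJs⟩ := exists_bounded_chain I a r (by positivity) ha hsum
  -- Among `2 * r + 2` members of the chain, whose sums take at most `2 * r + 1` values, two agree;
  -- their difference has sum zero.
  have hpig : ∃ x ∈ Finset.range (2 * r + 2), ∃ y ∈ Finset.range (2 * r + 2), x ≠ y ∧
      ∑ i ∈ J (x * q), a i = ∑ i ∈ J (y * q), a i := by
    apply Finset.exists_ne_map_eq_of_card_lt_of_maps_to (t := Finset.Icc (-(r : ℤ)) r)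
    · rw [Int.card_Icc, Finset.card_range]
      omega
    · intro x _
      exact Finset.mem_coe.mpr (Finset.mem_Icc.mpr (abs_le.mp (hJs (x * q))))
  have key : ∀ x y : ℕ, x < y → y < 2 * r + 2 → ∑ i ∈ J (x * q), a i = ∑ i ∈ J (y * q), a i →
      ∃ J ⊆ I, q ≤ J.card ∧ J.card ≤ (2 * r + 1) * q ∧ ∑ i ∈ J, a i = 0 := by
    intro x y hxy hy hs
    have hyq : y * q ≤ (2 * r + 1) * q := Nat.mul_le_mul_right q (by omega)
    have hxyq : x * q + q ≤ y * q := by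
      have : (x + 1) * q ≤ y * q := Nat.mul_le_mul_right q hxy
      linarith
    have hsub : J (x * q) ⊆ J (y * q) := hmono (by omega)
    have hcard : (J (y * q) \ J (x * q)).card = y * q - x * q := by
      rw [Finset.card_sdiff_of_subset hsub, hJc _ (by omega), hJc _ (by omega)]
    refine ⟨J (y * q) \ J (x * q), Finset.sdiff_subset.trans (hJI _), by omega, by omega, ?_⟩
    have := Finset.sum_sdiff (f := a) hsub
    omega
  obtain ⟨x, hx, y, hy, hne, hs⟩ := hpig
  rw [Finset.mem_range] at hx hy
  rcases Nat.lt_or_gt_of_ne hne with h | h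
  · exact key x y h hy hs
  · exact key y x h hx hs.symm

/-- Items with bounded integer balances of nonnegative sum can be grouped into few groups of bounded
size and nonnegative balance. -/
theorem exists_balanced_grouping {α : Type*} (I : Finset α) (a : α → ℤ) (r q : ℕ) (hq : 0 < q)
    (ha : ∀ i ∈ I, |a i| ≤ r) (hsum : 0 ≤ ∑ i ∈ I, a i) :
    ∃ (R : ℕ) (grp : α → ℕ), (∀ i ∈ I, grp i < R) ∧ R * q ≤ I.card + q ∧
      ∀ g, 0 ≤ ∑ i ∈ labelClass I grp g, a i ∧ (labelClass I grp g).card ≤ (2 * r + 1) * q := by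
  classical
  obtain ⟨b, hba, hbr, hb0⟩ := exists_sum_eq_zero_of_sum_nonneg I a r ha hsum
  suffices h : ∃ (R : ℕ) (grp : α → ℕ), (∀ i ∈ I, grp i < R) ∧ R * q ≤ I.card + q ∧
      ∀ g, 0 ≤ ∑ i ∈ labelClass I grp g, b i ∧ (labelClass I grp g).card ≤ (2 * r + 1) * q by
    obtain ⟨R, grp, h1, h2, h3⟩ := h
    exact ⟨R, grp, h1, h2, fun g => ⟨(h3 g).1.trans (Finset.sum_le_sum fun i _ => hba i), (h3 g).2⟩⟩
  clear hba ha hsum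
  induction hn : I.card using Nat.strong_induction_on generalizing I with
  | _ n ih =>
  rcases le_total I.card ((2 * r + 1) * q) with h | h
  · refine ⟨1, fun _ => 0, by simp, by omega, fun g => ?_⟩
    by_cases hg : g = 0
    · subst hg
      simp [labelClass, hb0, h]
    · simp [labelClass, Ne.symm hg]
  -- What remains after splitting off `J` has sum zero again; every group except the last has at
  -- least `q` items.
  · obtain ⟨J, hJI, hJq, hJu, hJ0⟩ := exists_zero_sum_subset I b r q hbr hb0 h
    have hc := Finset.card_sdiff_add_card_eq_card hJI
    obtain ⟨R, grp, h1, h2, h3⟩ := ih (I \ J).card (by omega) (I \ J)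
      (fun i hi => hbr i (Finset.mem_sdiff.mp hi).1) (by
        have := Finset.sum_sdiff (f := b) hJI
        omega) rfl
    refine ⟨R + 1, fun i => if i ∈ J then R else grp i, ?_, ?_, ?_⟩
    · intro i hi
      by_cases hiJ : i ∈ J
      · simp [hiJ]
      · have := h1 i (Finset.mem_sdiff.mpr ⟨hi, hiJ⟩)
        simp only [hiJ, if_false]
        omega
    · rw [add_mul]
      omega
    · intro g
      by_cases hg : g = R
      · subst hg
        have : labelClass I (fun i => if i ∈ J then g else grp i) g = J := by
          ext i
          simp only [labelClass, Finset.mem_filter]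
          constructor
          · rintro ⟨hi, hig⟩
            by_contra hiJ
            simp only [hiJ, if_false] at hig
            exact absurd hig (h1 i (Finset.mem_sdiff.mpr ⟨hi, hiJ⟩)).ne
          · intro hi
            exact ⟨hJI hi, by simp [hi]⟩
        rw [this]
        exact ⟨hJ0.ge, hJu⟩
      · have : labelClass I (fun i => if i ∈ J then R else grp i) g = labelClass (I \ J) grp g := by
          ext i
          simp only [labelClass, Finset.mem_filter, Finset.mem_sdiff]
          by_cases hiJ : i ∈ J <;> simp [hiJ, Ne.symm hg]
        rw [this]
        exact h3 g

/-- A weighted triangle inequality for `p`-th powers. -/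
theorem add_pow_le_relaxed (p : ℕ) {η a b : ℝ} (hη : 0 < η) (hη1 : η ≤ 1) (ha : 0 ≤ a)
    (hb : 0 ≤ b) : (a + b) ^ p ≤ (1 + η) * a ^ p + (1 + 2 ^ p / η) ^ p * b ^ p := by
  have h2p : (1 : ℝ) ≤ 2 ^ p := one_le_pow₀ (by norm_num)
  set τ : ℝ := η / 2 ^ p with hτ
  have hτ0 : 0 < τ := by positivity
  have hτ1 : τ ≤ 1 := by rw [hτ, div_le_one (by positivity)]; linarith
  -- A small `b` costs a factor `(1 + τ) ^ p ≤ 1 + 2 ^ p * τ = 1 + η`; a large one dominates `a`.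
  rcases le_total b (τ * a) with h | h
  · have hbern : (1 + τ) ^ p ≤ 1 + (2 ^ p - 1) * τ := by
      clear_value τ
      clear hτ h2p h
      induction p with
      | zero => simp
      | succ p ih =>
        have h1 : (1 : ℝ) ≤ 2 ^ p := one_le_pow₀ (by norm_num)
        have h3 : (0 : ℝ) ≤ (2 ^ p - 1) * τ := by nlinarith
        have h4 : (2 ^ p - 1) * τ * τ ≤ (2 ^ p - 1) * τ * 1 := by gcongr
        calc (1 + τ) ^ (p + 1) = (1 + τ) ^ p * (1 + τ) := pow_succ _ _
          _ ≤ (1 + (2 ^ p - 1) * τ) * (1 + τ) := by gcongr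
          _ ≤ 1 + (2 ^ (p + 1) - 1) * τ := by rw [pow_succ]; nlinarith
    have e : 2 ^ p * τ = η := by rw [hτ]; field_simp
    calc (a + b) ^ p ≤ ((1 + τ) * a) ^ p := by gcongr; linarith
      _ = (1 + τ) ^ p * a ^ p := mul_pow _ _ _
      _ ≤ (1 + η) * a ^ p := by gcongr; linarith
      _ ≤ _ := le_add_of_nonneg_right (by positivity)
  · have hab : a ≤ 2 ^ p / η * b := by
      have e : 2 ^ p / η * (τ * a) = a := by rw [hτ]; field_simp
      rw [← e]
      gcongr
    calc (a + b) ^ p ≤ ((1 + 2 ^ p / η) * b) ^ p := by gcongr; linarith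
      _ = (1 + 2 ^ p / η) ^ p * b ^ p := mul_pow _ _ _
      _ ≤ _ := le_add_of_nonneg_left (by positivity)

end

/-! ### Cost changes of exchanges -/

section

variable {X : Type*} [MetricSpace X]

theorem exists_nearest (S : Finset X) (hS : S.Nonempty) :
    ∃ σ : X → X, ∀ x, σ x ∈ S ∧ Metric.infDist x (S : Set X) = dist x (σ x) := by
  have : ∀ x, ∃ y, y ∈ S ∧ Metric.infDist x (S : Set X) = dist x y := fun x => by
    obtain ⟨y, hy, h⟩ := S.finite_toSet.isCompact.exists_infDist_eq_dist (Finset.coe_nonempty.mpr hS) x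
    exact ⟨y, hy, h⟩
  choose σ hσ using this
  exact ⟨σ, hσ⟩

theorem dist_nearest_le {S : Finset X} {σ : X → X}
    (hσ : ∀ x, σ x ∈ S ∧ Metric.infDist x (S : Set X) = dist x (σ x)) (x : X) {y : X}
    (hy : y ∈ S) : dist x (σ x) ≤ dist x y :=
  (hσ x).2 ▸ Metric.infDist_le_dist_of_mem hy

theorem cost_eq_sum_dist {p : ℕ} {C S : Finset X} {σ : X → X}
    (hσ : ∀ x, σ x ∈ S ∧ Metric.infDist x (S : Set X) = dist x (σ x)) :
    cost p C S = ∑ x ∈ C, dist x (σ x) ^ p :=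
  Finset.sum_congr rfl fun x _ => by rw [(hσ x).2]

theorem cost_nonneg (p : ℕ) (C S : Finset X) : 0 ≤ cost p C S :=
  Finset.sum_nonneg fun _ _ => pow_nonneg Metric.infDist_nonneg p

theorem cost_anti {p : ℕ} {C S T : Finset X} (hS : S.Nonempty) (h : S ⊆ T) :
    cost p C T ≤ cost p C S :=
  Finset.sum_le_sum fun _ _ => pow_le_pow_left₀ Metric.infDist_nonneg
    (Metric.infDist_le_infDist_of_subset (by exact_mod_cast h) (Finset.coe_nonempty.mpr hS)) p

open Classical in
/-- The solution obtained from `L` by exchanging its centers labelled `g` for those of `H` labelled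
`g` together with the portals `Z g`. -/
noncomputable def swapSet {J : Type*} (L H : Finset X) (lam kap : X → J) (Z : J → Finset X)
    (g : J) : Finset X :=
  (L.filter fun u => lam u ≠ g) ∪ labelClass H kap g ∪ Z g

/-- Whenever the nearest center `σ x` of a client and its target center `τ x` have different labels,
there is a substitute center that survives the exchange of the label of `σ x`. -/
def HasSubstitutes {J : Type*} (p : ℕ) (C L H : Finset X) (lam kap : X → J) (Z : J → Finset X)
    (σ τ : X → X) (e : X → ℝ) : Prop :=
  ∀ x ∈ C, lam (σ x) ≠ kap (τ x) → ∃ y,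
    dist x y ^ p ≤ max (dist x (σ x) ^ p) (dist x (τ x) ^ p) + e x ∧
    (y ∈ Z (lam (σ x)) ∨ (y ∈ H ∧ kap y = lam (σ x)) ∨ (y ∈ L ∧ lam y = kap (τ x)))

open Classical in
-- When its own label is exchanged the client moves to the substitute, at cost maximum plus `e x`;
-- when the target's label is exchanged it takes the nearer of `σ x` and `τ x`; otherwise `σ x`
-- survives. The charges `α`, `β` add up because maximum plus minimum is the sum.
theorem exists_mem_swapSet {J : Type*} {p : ℕ} {C L H : Finset X} {lam kap : X → J}
    {Z : J → Finset X} {σ τ : X → X} {e : X → ℝ} (hσ : ∀ x, σ x ∈ L) (hτ : ∀ x ∈ C, τ x ∈ H)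
    (he : ∀ x ∈ C, 0 ≤ e x) (hsub : HasSubstitutes p C L H lam kap Z σ τ e) {x : X} (hx : x ∈ C) :
    ∃ α β : ℝ, α + β ≤ dist x (τ x) ^ p + e x - dist x (σ x) ^ p ∧
      ∀ g, ∃ y ∈ swapSet L H lam kap Z g, dist x y ^ p - dist x (σ x) ^ p ≤
        (if g = lam (σ x) then α else 0) + (if g = kap (τ x) then β else 0) := by
  have hstay : ∀ g, g ≠ lam (σ x) → σ x ∈ swapSet L H lam kap Z g := fun g hg =>
    Finset.mem_union_left _ (Finset.mem_union_left _ (Finset.mem_filter.mpr ⟨hσ x, hg.symm⟩))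
  have htgt : τ x ∈ swapSet L H lam kap Z (kap (τ x)) :=
    Finset.mem_union_left _ (Finset.mem_union_right _ (Finset.mem_filter.mpr ⟨hτ x hx, rfl⟩))
  have he' := he x hx
  by_cases hab : lam (σ x) = kap (τ x)
  · refine ⟨dist x (τ x) ^ p - dist x (σ x) ^ p, 0, by linarith, fun g => ?_⟩
    by_cases hg : g = lam (σ x)
    · refine ⟨τ x, by rw [hg, hab]; exact htgt, by simp [hg]⟩
    · exact ⟨σ x, hstay g hg, by simp [hg]⟩
  · obtain ⟨y, hy, hymem⟩ := hsub x hx hab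
    refine ⟨max (dist x (σ x) ^ p) (dist x (τ x) ^ p) + e x - dist x (σ x) ^ p,
      min (dist x (σ x) ^ p) (dist x (τ x) ^ p) - dist x (σ x) ^ p, ?_, fun g => ?_⟩
    · have := max_add_min (dist x (σ x) ^ p) (dist x (τ x) ^ p)
      linarith
    · by_cases hga : g = lam (σ x)
      · subst hga
        refine ⟨y, ?_, ?_⟩
        · rcases hymem with h | ⟨h1, h2⟩ | ⟨h1, h2⟩
          · exact Finset.mem_union_right _ h
          · exact Finset.mem_union_left _
              (Finset.mem_union_right _ (Finset.mem_filter.mpr ⟨h1, h2⟩))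
          · exact Finset.mem_union_left _ (Finset.mem_union_left _
              (Finset.mem_filter.mpr ⟨h1, fun h => hab (h.symm.trans h2)⟩))
        · simp only [if_true, hab, if_false, add_zero]
          linarith
      · by_cases hgb : g = kap (τ x)
        · subst hgb
          rcases le_total (dist x (σ x) ^ p) (dist x (τ x) ^ p) with h | h
          · exact ⟨σ x, hstay _ hga, by simp [hga, min_eq_left h]⟩
          · exact ⟨τ x, htgt, by simp [hga, min_eq_right h]⟩
        · exact ⟨σ x, hstay g hga, by simp [hga, hgb]⟩

theorem sum_swap_cost_le {J : Type*} {p : ℕ} {C L H : Finset X} {lam kap : X → J}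
    {Z : J → Finset X} {σ τ : X → X} {e : X → ℝ} (𝒢 : Finset J)
    (hσ : ∀ x, σ x ∈ L ∧ Metric.infDist x (L : Set X) = dist x (σ x)) (hτ : ∀ x ∈ C, τ x ∈ H)
    (hlam : ∀ u ∈ L, lam u ∈ 𝒢) (hkap : ∀ u ∈ H, kap u ∈ 𝒢)
    (he : ∀ x ∈ C, 0 ≤ e x) (hsub : HasSubstitutes p C L H lam kap Z σ τ e) :
    ∑ g ∈ 𝒢, (cost p C (swapSet L H lam kap Z g) - cost p C L) ≤
      ∑ x ∈ C, dist x (τ x) ^ p + ∑ x ∈ C, e x - cost p C L := by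
  classical
  have hL := cost_eq_sum_dist (p := p) (C := C) hσ
  have h1 : ∑ g ∈ 𝒢, (cost p C (swapSet L H lam kap Z g) - cost p C L) =
      ∑ x ∈ C, ∑ g ∈ 𝒢,
        (Metric.infDist x (swapSet L H lam kap Z g : Set X) ^ p - dist x (σ x) ^ p) := by
    rw [Finset.sum_comm]
    refine Finset.sum_congr rfl fun g _ => ?_
    rw [Finset.sum_sub_distrib, hL]
    rfl
  rw [h1, hL, ← Finset.sum_add_distrib, ← Finset.sum_sub_distrib]
  refine Finset.sum_le_sum fun x hx => ?_
  obtain ⟨α, β, hαβ, h⟩ := exists_mem_swapSet (fun x => (hσ x).1) hτ he hsub hx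
  refine le_trans ?_ hαβ
  calc _ ≤ ∑ g ∈ 𝒢, ((if g = lam (σ x) then α else 0) + (if g = kap (τ x) then β else 0)) := by
        refine Finset.sum_le_sum fun g _ => ?_
        obtain ⟨y, hy, hle⟩ := h g
        refine le_trans (sub_le_sub_right ?_ _) hle
        exact pow_le_pow_left₀ Metric.infDist_nonneg (Metric.infDist_le_dist_of_mem hy) p
    _ = α + β := by
        rw [Finset.sum_add_distrib, Finset.sum_ite_eq', Finset.sum_ite_eq',
          if_pos (hlam _ (hσ x).1), if_pos (hkap _ (hτ x hx))]

/-- Substitutes survive a coarsening of the labels. -/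
theorem HasSubstitutes.comp {J J' : Type*} [DecidableEq X] {p : ℕ} {C L H : Finset X}
    {lam kap : X → J} {Z : J → Finset X} {σ τ : X → X} {e : X → ℝ} (I : Finset J)
    (hlam : ∀ x ∈ C, lam (σ x) ∈ I)
    (hsub : HasSubstitutes p C L H lam kap Z σ τ e) (grp : J → J') :
    HasSubstitutes p C L H (grp ∘ lam) (grp ∘ kap) (fun g => (labelClass I grp g).biUnion Z)
      σ τ e := by
  intro x hx hne
  obtain ⟨y, hy, h⟩ := hsub x hx fun h => hne (congrArg grp h)
  refine ⟨y, hy, ?_⟩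
  rcases h with h | ⟨h1, h2⟩ | ⟨h1, h2⟩
  · refine Or.inl (Finset.mem_biUnion.mpr ⟨lam (σ x), ?_, h⟩)
    exact mem_labelClass.mpr ⟨hlam x hx, rfl⟩
  · exact Or.inr (Or.inl ⟨h1, congrArg grp h2⟩)
  · exact Or.inr (Or.inr ⟨h1, congrArg grp h2⟩)

end

/-! ### Mismatched clients and loose centers -/

section

variable {X : Type*}

open Classical in
/-- The clients for which exactly one of the client and its center `σ x` is assigned to `f`. -/
noncomputable def mismatch (C : Finset X) (σ γ : X → X) (f : X) : Finset X :=
  C.filter fun x => ¬(γ x = f ↔ γ (σ x) = f)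

theorem mem_mismatch {C : Finset X} {σ γ : X → X} {f x : X} :
    x ∈ mismatch C σ γ f ↔ x ∈ C ∧ ¬(γ x = f ↔ γ (σ x) = f) := by
  classical
  simp [mismatch]

/-- A client is mismatched at most at the two centers `γ x` and `γ (σ x)`. -/
theorem sum_sum_mismatch_le (C F : Finset X) (σ γ : X → X) (w : X → ℝ) (hw : ∀ x, 0 ≤ w x) :
    ∑ f ∈ F, ∑ x ∈ mismatch C σ γ f, w x ≤ 2 * ∑ x ∈ C, w x := by
  classical
  have h1 : ∀ f, ∑ x ∈ mismatch C σ γ f, w x ≤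
      ∑ x ∈ C, ((if γ x = f then w x else 0) + (if γ (σ x) = f then w x else 0)) := by
    intro f
    rw [mismatch, Finset.sum_filter]
    refine Finset.sum_le_sum fun x _ => ?_
    have := hw x
    by_cases h1 : γ x = f <;> by_cases h2 : γ (σ x) = f <;> simp [h1, h2, this]
  refine (Finset.sum_le_sum fun f _ => h1 f).trans ?_
  rw [Finset.sum_comm, Finset.mul_sum]
  refine Finset.sum_le_sum fun x _ => ?_
  have := hw x
  rw [Finset.sum_add_distrib, Finset.sum_ite_eq, Finset.sum_ite_eq]
  split_ifs <;> linarith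

theorem sum_sum_labelClass_le {ι : Type*} (C : Finset X) (F : Finset ι) (γ : X → ι) (w : X → ℝ)
    (hw : ∀ x, 0 ≤ w x) : ∑ f ∈ F, ∑ x ∈ labelClass C γ f, w x ≤ ∑ x ∈ C, w x := by
  classical
  simp only [labelClass, Finset.sum_filter]
  rw [Finset.sum_comm]
  refine Finset.sum_le_sum fun x _ => ?_
  have := hw x
  rw [Finset.sum_ite_eq]
  split_ifs <;> linarith

theorem card_eq_sum_card_labelClass {ι : Type*} {L : Finset X} {F : Finset ι} {γ : X → ι}
    (h : ∀ u ∈ L, γ u ∈ F) : L.card = ∑ f ∈ F, (labelClass L γ f).card := by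
  classical
  exact Finset.card_eq_sum_card_fiberwise (f := γ) (t := F) h

variable {C L G : Finset X} {σ γ : X → X}

open Classical in
/-- A tight center of `G` has some partner in `L`, hence at most half of the centers outside pairs
are tight. -/
theorem card_le_two_mul_card_loose {k : ℕ} (hL : L.card = k) (hG : G.card = k)
    (hσ : ∀ x, σ x ∈ L) (hγ : ∀ x, γ x ∈ G) (tight : X → Prop)
    (htight : ∀ f ∈ G, tight f → (mismatch C σ γ f).card < (labelClass C γ f).card) :
    k - (G.filter fun f => tight f ∧ (labelClass L γ f).card = 1).card ≤
      2 * (G.filter fun f => ¬tight f).card := by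
  have hsum := card_eq_sum_card_labelClass (L := L) (F := G) (γ := γ) fun u _ => hγ u
  set I := G.filter fun f => tight f ∧ (labelClass L γ f).card = 1 with hI
  set N := G.filter fun f => ¬tight f with hN
  set M := G.filter fun f => tight f ∧ (labelClass L γ f).card ≠ 1 with hM
  have h1 : G.card ≤ I.card + M.card + N.card := by
    refine le_trans (Finset.card_le_card fun f hf => ?_)
      ((Finset.card_union_le (I ∪ M) N).trans (Nat.add_le_add_right (Finset.card_union_le I M) _))
    simp only [hI, hN, hM, Finset.mem_union, Finset.mem_filter]
    tauto
  have hdis : Disjoint I M := Finset.disjoint_left.mpr fun f hf hf' => by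
    rw [hI, Finset.mem_filter] at hf
    rw [hM, Finset.mem_filter] at hf'
    exact hf'.2.2 hf.2.2
  -- A tight center has a client outside the mismatch, whose `L`-center is a partner of it. If not
  -- isolated it therefore has two partners, and the partner classes partition `L`.
  have h2 : I.card + 2 * M.card ≤ ∑ f ∈ G, (labelClass L γ f).card := by
    calc I.card + 2 * M.card = ∑ f ∈ I, 1 + ∑ f ∈ M, 2 := by simp [mul_comm]
      _ ≤ ∑ f ∈ I, (labelClass L γ f).card + ∑ f ∈ M, (labelClass L γ f).card := by
          refine Nat.add_le_add (Finset.sum_le_sum fun f hf => ?_)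
            (Finset.sum_le_sum fun f hf => ?_)
          · rw [hI, Finset.mem_filter] at hf
            exact hf.2.2.ge
          · rw [hM, Finset.mem_filter] at hf
            have hlt := htight f hf.1 hf.2.1
            obtain ⟨x, hxV, hxU⟩ := Finset.exists_mem_notMem_of_card_lt_card hlt
            obtain ⟨hxC, hxf⟩ := mem_labelClass.mp hxV
            have hσf : γ (σ x) = f := by
              by_contra h
              exact hxU (mem_mismatch.mpr ⟨hxC, fun h' => h (h'.mp hxf)⟩)
            have : 0 < (labelClass L γ f).card :=
              Finset.card_pos.mpr ⟨σ x, mem_labelClass.mpr ⟨hσ x, hσf⟩⟩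
            have := hf.2.2
            omega
      _ = ∑ f ∈ I ∪ M, (labelClass L γ f).card := (Finset.sum_union hdis).symm
      _ ≤ _ := Finset.sum_le_sum_of_subset (Finset.union_subset (Finset.filter_subset _ _)
          (Finset.filter_subset _ _))
  omega

variable [MetricSpace X] {p : ℕ}

theorem sum_add_pow_le (hσ : ∀ x, σ x ∈ L ∧ Metric.infDist x (L : Set X) = dist x (σ x))
    (hγ : ∀ x, γ x ∈ G ∧ Metric.infDist x (G : Set X) = dist x (γ x)) :
    ∑ x ∈ C, (dist x (σ x) + dist x (γ x)) ^ p ≤ 2 ^ p * (cost p C L + cost p C G) := by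
  rw [cost_eq_sum_dist hσ, cost_eq_sum_dist hγ, ← Finset.sum_add_distrib, Finset.mul_sum]
  refine Finset.sum_le_sum fun x _ => (add_pow_le dist_nonneg dist_nonneg p).trans ?_
  gcongr
  · norm_num
  · omega

/-- Exactly one of `γ x`, `γ (σ x)` is `f`. The other is a competitor for the fallback, reached from
`f` through `σ x`. -/
theorem dist_fallback_le (hγ : ∀ x, γ x ∈ G ∧ Metric.infDist x (G : Set X) = dist x (γ x))
    {φ : X → X} {f x : X} (hφ : ∀ g ∈ G, g ≠ f → dist f (φ f) ≤ dist f g) (hf : f ∈ G)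
    (hx : x ∈ mismatch C σ γ f) : dist f (φ f) ≤ 2 * (dist x (σ x) + dist x (γ x)) := by
  have hxm := (mem_mismatch.mp hx).2
  by_cases h1 : γ x = f
  · have h2 : γ (σ x) ≠ f := fun h => hxm (iff_of_true h1 h)
    have a1 := hφ _ (hγ (σ x)).1 h2
    have a2 := dist_triangle_left f (γ (σ x)) (σ x)
    have a3 := dist_nearest_le hγ (σ x) hf
    have a4 := dist_triangle_left (σ x) f x
    rw [h1]
    linarith
  · have h2 : γ (σ x) = f := by
      by_contra h
      exact hxm (iff_of_false h1 h)
    have a1 := hφ _ (hγ x).1 h1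
    have a2 := dist_triangle_left f (γ x) (σ x)
    have a3 := dist_nearest_le hγ (σ x) (hγ x).1
    have a4 := dist_triangle_left (σ x) (γ x) x
    rw [h2] at a3
    linarith

/-- A loose center has at most `1 / ε` times as many clients as mismatched ones, and each mismatched
client can afford the way to the fallback. -/
theorem sum_removal_cost_le (hσ : ∀ x, σ x ∈ L ∧ Metric.infDist x (L : Set X) = dist x (σ x))
    (hγ : ∀ x, γ x ∈ G ∧ Metric.infDist x (G : Set X) = dist x (γ x)) {φ : X → X} {N : Finset X}
    {ε : ℝ} (hφ : ∀ f ∈ N, ∀ g ∈ G, g ≠ f → dist f (φ f) ≤ dist f g) (hN : N ⊆ G)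
    (hNε : ∀ f ∈ N, ε * (labelClass C γ f).card ≤ (mismatch C σ γ f).card) :
    ε * ∑ f ∈ N, (labelClass C γ f).card * dist f (φ f) ^ p ≤
      2 * 4 ^ p * (cost p C L + cost p C G) := by
  calc ε * ∑ f ∈ N, (labelClass C γ f).card * dist f (φ f) ^ p
      ≤ ∑ f ∈ N, ∑ x ∈ mismatch C σ γ f, 2 ^ p * (dist x (σ x) + dist x (γ x)) ^ p := by
        rw [Finset.mul_sum]
        refine Finset.sum_le_sum fun f hf => ?_
        rw [← mul_assoc]
        calc _ ≤ ((mismatch C σ γ f).card : ℝ) * dist f (φ f) ^ p := by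
              gcongr
              exact hNε f hf
          _ ≤ _ := by
              rw [← nsmul_eq_mul]
              refine Finset.card_nsmul_le_sum _ _ _ fun x hx => ?_
              rw [← mul_pow]
              exact pow_le_pow_left₀ dist_nonneg (dist_fallback_le hγ (hφ f hf) (hN hf) hx) p
    _ ≤ 2 * ∑ x ∈ C, 2 ^ p * (dist x (σ x) + dist x (γ x)) ^ p :=
        sum_sum_mismatch_le C N σ γ _ fun x => by positivity
    _ ≤ 2 * (2 ^ p * (2 ^ p * (cost p C L + cost p C G))) := by
        rw [← Finset.mul_sum]
        gcongr
        exact sum_add_pow_le hσ hγ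
    _ = _ := by
        have : (4 : ℝ) ^ p = 2 ^ p * 2 ^ p := by rw [← mul_pow]; norm_num
        rw [this]
        ring

/-- Clients served consistently by a pair `f`, `π f` pay for the mismatched ones. -/
theorem sum_mismatch_cost_le (hσ : ∀ x, σ x ∈ L ∧ Metric.infDist x (L : Set X) = dist x (σ x))
    (hγ : ∀ x, γ x ∈ G ∧ Metric.infDist x (G : Set X) = dist x (γ x)) {π : X → X} {I : Finset X}
    {ε : ℝ} (hε : 0 ≤ ε) (hε1 : ε ≤ 1 / 2)
    (hπ : ∀ f ∈ I, ∀ u ∈ L, γ u = f → u = π f)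
    (hI : ∀ f ∈ I, ((mismatch C σ γ f).card : ℝ) ≤ ε * (labelClass C γ f).card) :
    ∑ f ∈ I, (mismatch C σ γ f).card * dist f (π f) ^ p ≤
      2 * ε * 2 ^ p * (cost p C L + cost p C G) := by
  classical
  calc ∑ f ∈ I, (mismatch C σ γ f).card * dist f (π f) ^ p
      ≤ ∑ f ∈ I, ∑ x ∈ labelClass C γ f, 2 * ε * (dist x (σ x) + dist x (γ x)) ^ p := by
        refine Finset.sum_le_sum fun f hf => ?_
        have h1 := hI f hf
        set V := labelClass C γ f
        set U := mismatch C σ γ f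
        have h2 : (V.card : ℝ) ≤ (V \ U).card + U.card := by
          have := Finset.le_card_sdiff U V
          have : V.card ≤ (V \ U).card + U.card := by omega
          exact_mod_cast this
        -- At least half of `V` is consistent since `ε ≤ 1 / 2`; each consistent client bounds `dist
        -- f (π f)` by its own two distances.
        have h3 : (U.card : ℝ) ≤ (V \ U).card * (2 * ε) := by
          have : (0 : ℝ) ≤ V.card := by positivity
          nlinarith
        calc (U.card : ℝ) * dist f (π f) ^ p ≤ ((V \ U).card * (2 * ε)) * dist f (π f) ^ p := by
              gcongr
          _ = (V \ U).card • (2 * ε * dist f (π f) ^ p) := by rw [nsmul_eq_mul]; ring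
          _ ≤ ∑ x ∈ V \ U, 2 * ε * (dist x (σ x) + dist x (γ x)) ^ p := by
              refine Finset.card_nsmul_le_sum _ _ _ fun x hx => ?_
              obtain ⟨hxV, hxU⟩ := Finset.mem_sdiff.mp hx
              obtain ⟨hxC, hxf⟩ := mem_labelClass.mp hxV
              have hσf : γ (σ x) = f := by
                by_contra h
                exact hxU (mem_mismatch.mpr ⟨hxC, fun h' => h (h'.mp hxf)⟩)
              have := hπ f hf _ (hσ x).1 hσf
              rw [← this, hxf]
              gcongr
              rw [add_comm]
              exact dist_triangle_left f (σ x) x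
          _ ≤ _ := Finset.sum_le_sum_of_subset_of_nonneg Finset.sdiff_subset
              fun x _ _ => by positivity
    _ ≤ ∑ x ∈ C, 2 * ε * (dist x (σ x) + dist x (γ x)) ^ p :=
        sum_sum_labelClass_le C I γ _ fun x => by positivity
    _ ≤ 2 * ε * (2 ^ p * (cost p C L + cost p C G)) := by
        rw [← Finset.mul_sum]
        gcongr
        exact sum_add_pow_le hσ hγ
    _ = _ := by ring

end

/-! ### Labels of pairs and regions, substitutes -/

section

variable {X : Type*}

open Classical in
/-- Centers of isolated pairs are labelled by the pair, the others by their region. -/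
noncomputable def pairLabel {ι : Type*} (I : Finset X) (γ : X → X) (lab : X → ι) (u : X) : ι ⊕ X :=
  if γ u ∈ I then Sum.inr (γ u) else Sum.inl (lab u)

open Classical in
/-- The centers of `L` and `H` that do not belong to isolated pairs. -/
noncomputable def unpaired (L H I : Finset X) (γ : X → X) : Finset X :=
  (L.filter fun u => γ u ∉ I) ∪ (H.filter fun u => u ∉ I)

theorem labelClass_pairLabel_inr {ι : Type*} {L I : Finset X} {γ : X → X} {lab : X → ι} {f : X} :
    labelClass L (pairLabel I γ lab) (Sum.inr f) ⊆ labelClass L γ f := by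
  intro u hu
  rw [mem_labelClass] at hu ⊢
  refine ⟨hu.1, ?_⟩
  have := hu.2
  unfold pairLabel at this
  split_ifs at this
  exact Sum.inr.inj this

theorem labelClass_pairLabel_inl {ι : Type*} {L H I : Finset X} {γ : X → X} {lab : X → ι} {i : ι} :
    labelClass L (pairLabel I γ lab) (Sum.inl i) ⊆ labelClass (unpaired L H I γ) lab i := by
  classical
  intro u hu
  rw [mem_labelClass] at hu ⊢
  have := hu.2
  unfold pairLabel at this
  split_ifs at this with h
  exact ⟨Finset.mem_union_left _ (Finset.mem_filter.mpr ⟨hu.1, h⟩), Sum.inl.inj this⟩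

theorem labelClass_pairLabel_id_inl {ι : Type*} {L H I : Finset X} {γ : X → X} {lab : X → ι}
    {i : ι} : labelClass H (pairLabel I id lab) (Sum.inl i) ⊆
      labelClass (unpaired L H I γ) lab i := by
  classical
  intro u hu
  rw [mem_labelClass] at hu ⊢
  have := hu.2
  unfold pairLabel at this
  split_ifs at this with h
  exact ⟨Finset.mem_union_right _ (Finset.mem_filter.mpr ⟨hu.1, h⟩), Sum.inl.inj this⟩

theorem card_pairLabel_classes_le {ι : Type*} {L H I : Finset X} {γ : X → X} {lab : X → ι}
    {Z : ι → Finset X} {r : ℝ} (hr : 1 ≤ r)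
    (hI : ∀ f ∈ I, (labelClass L γ f).card = 1)
    (hZ : ∀ i, (((labelClass (unpaired L H I γ) lab i).card + (Z i).card : ℕ) : ℝ) ≤ r)
    (j : ι ⊕ X) :
    (((labelClass L (pairLabel I γ lab) j).card + (labelClass H (pairLabel I id lab) j).card +
      (Sum.elim Z (fun _ => ∅) j).card : ℕ) : ℝ) ≤ 2 * r := by
  rcases j with i | f
  · have h1 := Finset.card_le_card
      (labelClass_pairLabel_inl (L := L) (H := H) (I := I) (γ := γ) (lab := lab) (i := i))
    have h2 := Finset.card_le_card
      (labelClass_pairLabel_id_inl (L := L) (H := H) (I := I) (γ := γ) (lab := lab) (i := i))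
    have h3 := hZ i
    have h4 : (labelClass L (pairLabel I γ lab) (Sum.inl i)).card +
        (labelClass H (pairLabel I id lab) (Sum.inl i)).card + (Z i).card ≤
        2 * ((labelClass (unpaired L H I γ) lab i).card + (Z i).card) := by omega
    calc _ ≤ ((2 * ((labelClass (unpaired L H I γ) lab i).card + (Z i).card) : ℕ) : ℝ) := by
          exact_mod_cast h4
      _ ≤ 2 * r := by push_cast at h3 ⊢; linarith
  · have h1 : (labelClass L (pairLabel I γ lab) (Sum.inr f)).card ≤ 1 := by
      by_cases hf : f ∈ I
      · exact (Finset.card_le_card labelClass_pairLabel_inr).trans (hI f hf).le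
      · have : labelClass L (pairLabel I γ lab) (Sum.inr f) = ∅ := by
          refine Finset.eq_empty_of_forall_notMem fun u hu => ?_
          have hγ := (mem_labelClass.mp (labelClass_pairLabel_inr hu)).2
          have h := (mem_labelClass.mp hu).2
          rw [pairLabel, hγ, if_neg hf] at h
          cases h
        simp [this]
    have h2 : (labelClass H (pairLabel I id lab) (Sum.inr f)).card ≤ 1 := by
      rw [Finset.card_le_one]
      intro a ha b hb
      have ha' := (mem_labelClass.mp (labelClass_pairLabel_inr ha)).2
      have hb' := (mem_labelClass.mp (labelClass_pairLabel_inr hb)).2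
      exact ha'.trans hb'.symm
    have h3 : (labelClass L (pairLabel I γ lab) (Sum.inr f)).card +
        (labelClass H (pairLabel I id lab) (Sum.inr f)).card +
        (Sum.elim Z (fun _ => ∅) (Sum.inr f) : Finset X).card ≤ 2 := by
      simp only [Sum.elim_inr, Finset.card_empty]
      omega
    calc _ ≤ ((2 : ℕ) : ℝ) := by exact_mod_cast h3
      _ ≤ 2 * r := by push_cast; linarith

theorem sum_card_sumElim_le {ι : Type*} [Fintype ι] (Z : ι → Finset X) (J : Finset (ι ⊕ X)) :
    ∑ j ∈ J, (Sum.elim Z (fun _ => ∅) j).card ≤ ∑ i, (Z i).card := by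
  classical
  calc ∑ j ∈ J, (Sum.elim Z (fun _ => ∅) j).card
      ≤ ∑ j ∈ Finset.univ.disjSum J.toRight, (Sum.elim Z (fun _ => ∅) j).card :=
        Finset.sum_le_sum_of_subset fun j hj => by
          rcases j with i | f <;> simp [hj]
    _ = ∑ i, (Z i).card := by rw [Finset.sum_disjSum]; simp

variable [MetricSpace X] {p : ℕ} {C L G : Finset X} {σ γ : X → X}

open Classical in
/-- The client assignment after the centers of `F` have been removed. -/
noncomputable def reassign (F : Finset X) (γ φ : X → X) (x : X) : X :=
  if γ x ∈ F then φ (γ x) else γ x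

/-- If `σ x` is paired, the `H`-center of its pair opens in the same exchange; if the target is
paired, its partner in `L` stays open. Either way `x` is mismatched at that pair and the detour is
the length of the pair. If neither is paired, the division supplies a portal. -/
theorem exists_substitute {ι : Type*} {H F I : Finset X} {φ π : X → X} {lab : X → ι}
    {Z : ι → Finset X} (hσ : ∀ x, σ x ∈ L)
    (hIH : I ⊆ H) (hIF : Disjoint I F) (hFφ : ∀ f ∈ F, φ f ∉ I)
    (hπL : ∀ f ∈ I, π f ∈ L ∧ γ (π f) = f) (hπ : ∀ f ∈ I, ∀ u ∈ L, γ u = f → u = π f)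
    (hτ : ∀ x, reassign F γ φ x ∈ H)
    (hball : ∀ x, ∀ a ∈ unpaired L H I γ, ∀ b ∈ unpaired L H I γ, lab a ≠ lab b →
      ∃ z ∈ Z (lab a), dist x z ≤ max (dist x a) (dist x b))
    {x : X} (hx : x ∈ C)
    (hne : pairLabel I γ lab (σ x) ≠ pairLabel I id lab (reassign F γ φ x)) :
    ∃ y, (dist x y ≤ max (dist x (σ x)) (dist x (reassign F γ φ x)) ∨
        ∃ f ∈ I, x ∈ mismatch C σ γ f ∧
          dist x y ≤ max (dist x (σ x)) (dist x (reassign F γ φ x)) + dist f (π f)) ∧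
      (y ∈ (Sum.elim Z (fun _ => ∅) (pairLabel I γ lab (σ x)) : Finset X) ∨
        (y ∈ H ∧ pairLabel I id lab y = pairLabel I γ lab (σ x)) ∨
        (y ∈ L ∧ pairLabel I γ lab y = pairLabel I id lab (reassign F γ φ x))) := by
  classical
  set t := reassign F γ φ x with ht
  by_cases h1 : γ (σ x) ∈ I
  · have e1 : pairLabel I γ lab (σ x) = Sum.inr (γ (σ x)) := if_pos h1
    have htne : t ≠ γ (σ x) := by
      intro h
      apply hne
      rw [e1, ← h]
      exact (if_pos (show id t ∈ I by rw [id, h]; exact h1)).symm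
    have hγx : γ x ≠ γ (σ x) := by
      intro h
      apply htne
      rw [ht, reassign, if_neg, h]
      rw [h]
      exact Finset.disjoint_left.mp hIF h1
    refine ⟨γ (σ x), Or.inr ⟨γ (σ x), h1, mem_mismatch.mpr ⟨hx, fun h => hγx (h.mpr rfl)⟩, ?_⟩,
      Or.inr (Or.inl ⟨hIH h1, ?_⟩)⟩
    · rw [← hπ _ h1 _ (hσ x) rfl]
      have := dist_triangle_right x (γ (σ x)) (σ x)
      linarith [le_max_left (dist x (σ x)) (dist x t)]
    · rw [e1]
      exact if_pos h1
  · by_cases h2 : t ∈ I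
    -- Fallbacks are never paired, so a paired target was not reassigned.
    · have hγF : γ x ∉ F := by
        intro h
        rw [ht, reassign, if_pos h] at h2
        exact hFφ _ h h2
      have hγt : γ x = t := by rw [ht, reassign, if_neg hγF]
      have e2 : pairLabel I id lab t = Sum.inr t := if_pos h2
      refine ⟨π t, Or.inr ⟨t, h2, mem_mismatch.mpr ⟨hx, fun h => h1 ?_⟩, ?_⟩,
        Or.inr (Or.inr ⟨(hπL t h2).1, ?_⟩)⟩
      · rw [h.mp hγt]
        exact h2
      · have := dist_triangle x t (π t)
        linarith [le_max_right (dist x (σ x)) (dist x t)]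
      · rw [e2, pairLabel, (hπL t h2).2, if_pos h2]
    · have e1 : pairLabel I γ lab (σ x) = Sum.inl (lab (σ x)) := if_neg h1
      have e2 : pairLabel I id lab t = Sum.inl (lab t) := if_neg h2
      rw [e1, e2] at hne
      obtain ⟨z, hz, hxz⟩ := hball x (σ x)
        (Finset.mem_union_left _ (Finset.mem_filter.mpr ⟨hσ x, h1⟩)) t
        (Finset.mem_union_right _ (Finset.mem_filter.mpr ⟨hτ x, h2⟩)) fun h => hne (by rw [h])
      exact ⟨z, Or.inl hxz, Or.inl (by rw [e1]; exact hz)⟩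

theorem sum_reassign_cost_le (hγ : ∀ x, γ x ∈ G ∧ Metric.infDist x (G : Set X) = dist x (γ x))
    {F : Finset X} {φ : X → X} {η M : ℝ} (hη0 : 0 ≤ η)
    (hη : ∀ a b : ℝ, 0 ≤ a → 0 ≤ b → (a + b) ^ p ≤ (1 + η) * a ^ p + M * b ^ p) :
    ∑ x ∈ C, dist x (reassign F γ φ x) ^ p ≤
      (1 + η) * cost p C G + M * ∑ f ∈ F, (labelClass C γ f).card * dist f (φ f) ^ p := by
  classical
  have h1 : ∑ f ∈ F, ((labelClass C γ f).card : ℝ) * dist f (φ f) ^ p =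
      ∑ x ∈ C, if γ x ∈ F then dist (γ x) (φ (γ x)) ^ p else 0 := by
    have : ∀ f ∈ F, ((labelClass C γ f).card : ℝ) * dist f (φ f) ^ p =
        ∑ x ∈ C, if γ x = f then dist (γ x) (φ (γ x)) ^ p else 0 := fun f _ => by
      rw [← Finset.sum_filter, ← nsmul_eq_mul, ← Finset.sum_const]
      exact Finset.sum_congr rfl fun x hx => by rw [(mem_labelClass.mp hx).2]
    rw [Finset.sum_congr rfl this, Finset.sum_comm]
    exact Finset.sum_congr rfl fun x _ => Finset.sum_ite_eq _ _ _
  rw [h1, cost_eq_sum_dist hγ, Finset.mul_sum, Finset.mul_sum, ← Finset.sum_add_distrib]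
  refine Finset.sum_le_sum fun x _ => ?_
  by_cases h : γ x ∈ F
  · rw [reassign, if_pos h, if_pos h]
    refine le_trans ?_ (hη _ _ dist_nonneg dist_nonneg)
    exact pow_le_pow_left₀ dist_nonneg (dist_triangle _ _ _) p
  · rw [reassign, if_neg h, if_neg h]
    have : 0 ≤ dist x (γ x) ^ p := by positivity
    nlinarith

end

/-! ### Cheap removals and the family of exchanges -/

section

universe u

variable {X : Type u} [MetricSpace X] {p : ℕ} {C L G : Finset X} {σ γ : X → X}

/-- `X` admits divisions of finite sets into regions of size at most `r`, with at most `η` boundary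
points per point. -/
def HasDivisions (X : Type*) [MetricSpace X] (η r : ℝ) : Prop :=
  ∀ P : Finset X, ∃ (ι : Type) (_ : Fintype ι) (lab : X → ι) (Z : ι → Finset X),
    (∀ i, (((labelClass P lab i).card + (Z i).card : ℕ) : ℝ) ≤ r) ∧
    ((∑ i, (Z i).card : ℕ) : ℝ) ≤ η * P.card ∧
    ∀ x, ∀ a ∈ P, ∀ b ∈ P, lab a ≠ lab b → ∃ z ∈ Z (lab a), dist x z ≤ max (dist x a) (dist x b)

omit [MetricSpace X] in
theorem card_unpaired_le {k : ℕ} {H I : Finset X} (hL : L.card = k) (hG : G.card = k)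
    (hH : H ⊆ G) (hI : I ⊆ G) (hI1 : ∀ f ∈ I, (labelClass L γ f).card = 1) :
    (unpaired L H I γ).card ≤ 2 * (k - I.card) := by
  classical
  have h1 : I.card ≤ (L.filter fun u => γ u ∈ I).card := by
    apply Finset.card_le_card_of_surjOn γ
    intro f hf
    obtain ⟨u, hu⟩ := Finset.card_pos.mp (by rw [hI1 f hf]; norm_num : 0 < (labelClass L γ f).card)
    obtain ⟨huL, huf⟩ := mem_labelClass.mp hu
    exact ⟨u, by simpa [huL, huf] using hf, huf⟩
  have h2 : (L.filter fun u => γ u ∈ I).card + (L.filter fun u => γ u ∉ I).card = L.card :=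
    Finset.card_filter_add_card_filter_not _
  have h3 : (H.filter fun u => u ∉ I).card ≤ (G \ I).card :=
    Finset.card_le_card fun u hu => by
      rw [Finset.mem_filter] at hu
      exact Finset.mem_sdiff.mpr ⟨hH hu.1, hu.2⟩
  have h4 := Finset.card_sdiff_add_card_eq_card hI
  have h5 : (unpaired L H I γ).card ≤
      (L.filter fun u => γ u ∉ I).card + (H.filter fun u => u ∉ I).card := by
    convert Finset.card_union_le _ _ using 2
    unfold unpaired
    congr
  omega

theorem cheap_removal_bound {M δ ε η W a t c u v : ℝ} (hε : 0 < ε) (hδ : 0 ≤ δ) (hM : 0 ≤ M)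
    (hW : 0 ≤ W) (ha : 0 < a) (hv : 0 ≤ v) (hta : t ≤ 12 * δ * a)
    (hMδ : M * (24 * c * δ) ≤ η * ε) (hu : u * a ≤ t * v) (hvW : ε * v ≤ 2 * c * W) :
    M * u ≤ η * W := by
  have h1 : u * a ≤ (12 * δ * v) * a := by
    calc u * a ≤ t * v := hu
      _ ≤ (12 * δ * a) * v := by gcongr
      _ = _ := by ring
  have h2 := le_of_mul_le_mul_right h1 ha
  refine le_of_mul_le_mul_left ?_ hε
  calc ε * (M * u) ≤ ε * (M * (12 * δ * v)) := by gcongr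
    _ = M * (12 * δ) * (ε * v) := by ring
    _ ≤ M * (12 * δ) * (2 * c * W) := by gcongr
    _ = M * (24 * c * δ) * W := by ring
    _ ≤ η * ε * W := by gcongr
    _ = ε * (η * W) := by ring

open Classical in
/-- Removal of a few centers of `G` that are cheap to remove, with a division of the centers outside
isolated pairs whose boundary is no larger than the number of removed centers. -/
theorem exists_removal {k : ℕ} (hL : L.card = k) (hG : G.card = k)
    (hσ : ∀ x, σ x ∈ L ∧ Metric.infDist x (L : Set X) = dist x (σ x))
    (hγ : ∀ x, γ x ∈ G ∧ Metric.infDist x (G : Set X) = dist x (γ x))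
    {η M ε δ r : ℝ} (hη : 0 ≤ η) (hM : 0 ≤ M) (hε : 0 < ε) (hε1 : ε ≤ 1) (hδ : 0 < δ)
    (hδ1 : δ ≤ 1 / 12) (hMδ : M * (24 * 4 ^ p * δ) ≤ η * ε) (hr : 2 / δ ≤ r)
    (hdiv : HasDivisions X (δ / 4) r) :
    ∃ (F I : Finset X) (φ : X → X) (ι : Type) (_ : Fintype ι) (lab : X → ι) (Z : ι → Finset X),
      F ⊆ G ∧ I ⊆ G ∧ Disjoint I F ∧ (∀ f ∈ F, φ f ∈ G ∧ φ f ∉ F ∧ φ f ∉ I) ∧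
      (∀ f ∈ I, (labelClass L γ f).card = 1 ∧
        ((mismatch C σ γ f).card : ℝ) ≤ ε * (labelClass C γ f).card) ∧
      M * ∑ f ∈ F, (labelClass C γ f).card * dist f (φ f) ^ p ≤
        η * (cost p C L + cost p C G) ∧
      (∀ i, (((labelClass (unpaired L (G \ F) I γ) lab i).card + (Z i).card : ℕ) : ℝ) ≤ r) ∧
      ∑ i, (Z i).card ≤ F.card ∧
      ∀ x, ∀ a ∈ unpaired L (G \ F) I γ, ∀ b ∈ unpaired L (G \ F) I γ, lab a ≠ lab b →
        ∃ z ∈ Z (lab a), dist x z ≤ max (dist x a) (dist x b) := by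
  set W := cost p C L + cost p C G with hW
  have hW0 : 0 ≤ W := add_nonneg (cost_nonneg _ _ _) (cost_nonneg _ _ _)
  let tight : X → Prop := fun f => ((mismatch C σ γ f).card : ℝ) < ε * (labelClass C γ f).card
  have htight : ∀ f ∈ G, tight f → (mismatch C σ γ f).card < (labelClass C γ f).card := by
    intro f _ hf
    have : (0 : ℝ) ≤ (labelClass C γ f).card := by positivity
    have : ((mismatch C σ γ f).card : ℝ) < (labelClass C γ f).card := by
      have : ((mismatch C σ γ f).card : ℝ) < ε * (labelClass C γ f).card := hf
      nlinarith
    exact_mod_cast this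
  have hcount := card_le_two_mul_card_loose hL hG (fun x => (hσ x).1) (fun x => (hγ x).1)
    tight htight
  set I₁ := G.filter fun f => tight f ∧ (labelClass L γ f).card = 1 with hI₁
  set N := G.filter fun f => ¬tight f with hN
  have hI₁G : I₁ ⊆ G := Finset.filter_subset _ _
  have hNG : N ⊆ G := Finset.filter_subset _ _
  have hI₁p : ∀ f ∈ I₁, (labelClass L γ f).card = 1 ∧
      ((mismatch C σ γ f).card : ℝ) ≤ ε * (labelClass C γ f).card := fun f hf => by
    rw [hI₁, Finset.mem_filter] at hf
    exact ⟨hf.2.2, hf.2.1.le⟩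
  have hIN : Disjoint I₁ N := Finset.disjoint_left.mpr fun f hf hf' => by
    rw [hI₁, Finset.mem_filter] at hf
    rw [hN, Finset.mem_filter] at hf'
    exact hf'.2 hf.2.1
  have hI₁k : I₁.card ≤ k := hG ▸ Finset.card_le_card hI₁G
  set K := k - I₁.card with hK
  -- With so few unpaired centers one region without boundary is small enough, and nothing is
  -- removed.
  by_cases hsmall : (K : ℝ) < 1 / δ
  · refine ⟨∅, I₁, id, Unit, inferInstance, fun _ => (), fun _ => ∅, by simp, hI₁G, by simp,
      by simp, hI₁p, ?_, ?_, by simp, fun _ _ _ _ _ h => absurd rfl h⟩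
    · simp only [Finset.sum_empty, mul_zero]
      positivity
    · intro _
      have h1 := card_unpaired_le (γ := γ) hL hG (Finset.sdiff_subset (t := ∅)) hI₁G
        fun f hf => (hI₁p f hf).1
      have h2 : (labelClass (unpaired L (G \ ∅) I₁ γ) (fun _ => ()) ()).card ≤
          (unpaired L (G \ ∅) I₁ γ).card := Finset.card_le_card labelClass_subset
      have h3 : ((labelClass (unpaired L (G \ ∅) I₁ γ) (fun _ => ()) ()).card : ℝ) ≤ 2 * K := by
        exact_mod_cast h2.trans h1
      have h4 : 2 / δ = 2 * (1 / δ) := by ring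
      rw [Finset.card_empty, add_zero]
      linarith
  push Not at hsmall
  have hδK : 1 ≤ δ * K := by
    rw [div_le_iff₀ hδ] at hsmall
    linarith
  have hK12 : (12 : ℝ) ≤ K := by nlinarith
  have hK12' : 12 ≤ K := by exact_mod_cast hK12
  have hfb : ∀ f, ∃ g, g ∈ G.erase f ∧ ∀ g' ∈ G, g' ≠ f → dist f g ≤ dist f g' := by
    intro f
    have hne : (G.erase f).Nonempty := by
      apply Finset.card_pos.mp
      have := Finset.pred_card_le_card_erase (s := G) (a := f)
      omega
    obtain ⟨ν, hν⟩ := exists_nearest (G.erase f) hne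
    exact ⟨ν f, (hν f).1, fun g' hg' hne => dist_nearest_le hν f (Finset.mem_erase.mpr ⟨hne, hg'⟩)⟩
  choose φ hφG hφ using hfb
  -- At least `K / 2` centers are loose, so `A` has at least `K / 6`. By independence no fallback of
  -- a removed center is itself removed.
  obtain ⟨A, hAN, hAc, hAind⟩ := exists_independent φ N
    fun f _ => (Finset.mem_erase.mp (hφG f)).1
  set t := ⌈δ * K⌉₊ with ht
  have htl : δ * K ≤ t := Nat.le_ceil _
  have htu : (t : ℝ) ≤ 2 * (δ * K) := by
    have := (Nat.ceil_lt_add_one (by linarith : 0 ≤ δ * K)).le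
    linarith
  have hKA : (K : ℝ) ≤ 6 * A.card := by
    have : K ≤ 6 * A.card := by omega
    exact_mod_cast this
  have htA : t ≤ A.card := by
    have : (t : ℝ) ≤ A.card := by nlinarith
    exact_mod_cast this
  have htK : t ≤ K := by
    have : (t : ℝ) ≤ K := by nlinarith
    exact_mod_cast this
  obtain ⟨F, hFA, hFt, hFw⟩ := exists_cheap_subset A
    (fun f => ((labelClass C γ f).card : ℝ) * dist f (φ f) ^ p) t htA
  have hFN : F ⊆ N := hFA.trans hAN
  -- Pairs of fallbacks are dissolved. That adds at most `t ≤ K` unpaired centers per side, hence `4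
  -- * K` in all and a boundary of at most `δ / 4 * (4 * K) ≤ t = F.card`.
  set I := I₁ \ F.image φ with hI
  have hII₁ : I ⊆ I₁ := Finset.sdiff_subset
  have hIc : K + t ≥ k - I.card := by
    have h1 : I₁.card - (F.image φ).card ≤ I.card := Finset.le_card_sdiff _ _
    have h2 := Finset.card_image_le (s := F) (f := φ)
    omega
  obtain ⟨ι, hι, lab, Z, hZr, hZs, hZb⟩ := hdiv (unpaired L (G \ F) I γ)
  refine ⟨F, I, φ, ι, hι, lab, Z, hFN.trans hNG, hII₁.trans hI₁G,
    (hIN.mono_left hII₁).mono_right hFN, fun f hf => ⟨(Finset.mem_erase.mp (hφG f)).2,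
      fun h => hAind f (hFA hf) (hFA h),
      fun h => (Finset.mem_sdiff.mp h).2 (Finset.mem_image_of_mem φ hf)⟩,
    fun f hf => hI₁p f (hII₁ hf), ?_, hZr, ?_, hZb⟩
  · set w : X → ℝ := fun f => ((labelClass C γ f).card : ℝ) * dist f (φ f) ^ p with hw
    have hw0 : ∀ f, 0 ≤ w f := fun f => by positivity
    have hAN' : ∑ f ∈ A, w f ≤ ∑ f ∈ N, w f :=
      Finset.sum_le_sum_of_subset_of_nonneg hAN fun f _ _ => hw0 f
    have hNW := sum_removal_cost_le (p := p) (C := C) hσ hγ (φ := φ) (N := N) (ε := ε)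
      (fun f _ => hφ f) hNG fun f hf => by
        rw [hN, Finset.mem_filter] at hf
        exact not_lt.mp hf.2
    have hA0 : (0 : ℝ) < A.card := by linarith
    have hN0 : 0 ≤ ∑ f ∈ N, w f := Finset.sum_nonneg fun f _ => hw0 f
    have hta : (t : ℝ) ≤ 12 * δ * A.card := htu.trans (by nlinarith)
    exact cheap_removal_bound hε hδ.le hM hW0 hA0 hN0 hta hMδ
      (hFw.trans (by gcongr)) hNW
  · have h1 := card_unpaired_le (γ := γ) hL hG (Finset.sdiff_subset (s := G) (t := F))
      (hII₁.trans hI₁G) fun f hf => (hI₁p f (hII₁ hf)).1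
    have h2 : (unpaired L (G \ F) I γ).card ≤ 4 * K := by omega
    have h3 : ((unpaired L (G \ F) I γ).card : ℝ) ≤ 4 * K := by exact_mod_cast h2
    have h4 : ((∑ i, (Z i).card : ℕ) : ℝ) ≤ F.card := by
      rw [hFt]
      nlinarith
    exact_mod_cast h4

/-- A family of small exchanges, almost balanced and with small total error. -/
theorem exists_exchange_structure {k : ℕ} (hL : L.card = k) (hG : G.card = k)
    (hσ : ∀ x, σ x ∈ L ∧ Metric.infDist x (L : Set X) = dist x (σ x)) (hk : 0 < k)
    {η M ε δ r : ℝ} (hη : 0 ≤ η) (hη1 : η ≤ 1) (hM : 0 ≤ M) (hε : 0 < ε) (hε1 : ε ≤ 1 / 2)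
    (hδ : 0 < δ) (hδ1 : δ ≤ 1 / 12)
    (hpow : ∀ a b : ℝ, 0 ≤ a → 0 ≤ b → (a + b) ^ p ≤ (1 + η) * a ^ p + M * b ^ p)
    (hMε : M * (2 * ε * 2 ^ p) ≤ η) (hMδ : M * (24 * 4 ^ p * δ) ≤ η * ε) (hr : 2 / δ ≤ r)
    (hdiv : HasDivisions X (δ / 4) r) :
    ∃ (J : Type u) (H : Finset X) (lam kap : X → J) (Z : J → Finset X) (e : X → ℝ) (τ : X → X),
      H ⊆ G ∧
      (∀ j, (((labelClass L lam j).card + (labelClass H kap j).card + (Z j).card : ℕ) : ℝ) ≤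
        2 * r) ∧
      (∀ I : Finset J, H.card + ∑ j ∈ I, (Z j).card ≤ k) ∧
      (∀ x, τ x ∈ H) ∧ (∀ x, 0 ≤ e x) ∧ HasSubstitutes p C L H lam kap Z σ τ e ∧
      ∑ x ∈ C, dist x (τ x) ^ p + ∑ x ∈ C, e x ≤
        cost p C G + 8 * η * (cost p C L + cost p C G) := by
  classical
  obtain ⟨γ, hγ⟩ := exists_nearest G (Finset.card_pos.mp (by omega))
  obtain ⟨F, I, φ, ι, hι, lab, Z, hFG, hIG, hIF, hφ, hI, hF, hZr, hZs, hZb⟩ :=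
    exists_removal (p := p) (C := C) hL hG hσ hγ hη hM hε (by linarith) hδ hδ1 hMδ hr hdiv
  set W := cost p C L + cost p C G with hW
  have hW0 : 0 ≤ W := add_nonneg (cost_nonneg _ _ _) (cost_nonneg _ _ _)
  have hπex : ∀ f, ∃ u, f ∈ I → labelClass L γ f = {u} := fun f => by
    by_cases hf : f ∈ I
    · obtain ⟨u, hu⟩ := Finset.card_eq_one.mp (hI f hf).1
      exact ⟨u, fun _ => hu⟩
    · exact ⟨f, fun h => absurd h hf⟩
  choose π hπ using hπex
  have hπL : ∀ f ∈ I, π f ∈ L ∧ γ (π f) = f := fun f hf =>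
    mem_labelClass.mp (by rw [hπ f hf]; exact Finset.mem_singleton_self _)
  have hπu : ∀ f ∈ I, ∀ u ∈ L, γ u = f → u = π f := fun f hf u hu huf => by
    have : u ∈ labelClass L γ f := mem_labelClass.mpr ⟨hu, huf⟩
    rw [hπ f hf] at this
    exact Finset.mem_singleton.mp this
  set τ := reassign F γ φ with hτ
  have hτH : ∀ x, τ x ∈ G \ F := fun x => by
    rw [hτ, reassign, Finset.mem_sdiff]
    split_ifs with h
    · exact ⟨(hφ _ h).1, (hφ _ h).2.1⟩
    · exact ⟨(hγ x).1, h⟩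
  have hIH : I ⊆ G \ F := fun f hf =>
    Finset.mem_sdiff.mpr ⟨hIG hf, Finset.disjoint_left.mp hIF hf⟩
  have hr1 : 1 ≤ r := by
    refine le_trans ?_ hr
    rw [le_div_iff₀ hδ]
    linarith
  -- The first term is the loss in the relaxed triangle inequality, the second the detour along
  -- pairs at which `x` is mismatched.
  let e : X → ℝ := fun x => η * (dist x (σ x) ^ p + dist x (τ x) ^ p) +
    M * ∑ f ∈ I, if x ∈ mismatch C σ γ f then dist f (π f) ^ p else 0
  have hite : ∀ x f, 0 ≤ (if x ∈ mismatch C σ γ f then dist f (π f) ^ p else 0) := fun x f => by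
    split_ifs <;> positivity
  have hmaxpow : ∀ a b : ℝ, 0 ≤ a → 0 ≤ b → max a b ^ p ≤ max (a ^ p) (b ^ p) := by
    intro a b _ _
    rcases le_total a b with h | h
    · rw [max_eq_right h]; exact le_max_right _ _
    · rw [max_eq_left h]; exact le_max_left _ _
  refine ⟨ι ⊕ X, G \ F, pairLabel I γ lab, pairLabel I id lab, Sum.elim Z fun _ => ∅,
    e, τ, Finset.sdiff_subset, ?_, ?_, hτH, ?_, ?_, ?_⟩
  · exact card_pairLabel_classes_le hr1 (fun f hf => (hI f hf).1) hZr
  -- The removed centers make room for all portals.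
  · intro J
    have h1 := sum_card_sumElim_le Z J
    have h2 := Finset.card_sdiff_add_card_eq_card hFG
    omega
  · intro x
    have := Finset.sum_nonneg fun f (_ : f ∈ I) => hite x f
    positivity
  · intro x hx hne
    obtain ⟨y, hy, hmem⟩ := exists_substitute (fun x => (hσ x).1) hIH hIF
      (fun f hf => (hφ f hf).2.2) hπL hπu hτH hZb hx hne
    refine ⟨y, ?_, hmem⟩
    have hs := Finset.sum_nonneg fun f (_ : f ∈ I) => hite x f
    have hmp := hmaxpow (dist x (σ x)) (dist x (τ x)) dist_nonneg dist_nonneg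
    rcases hy with hy | ⟨f, hf, hxf, hy⟩
    · refine ((pow_le_pow_left₀ dist_nonneg hy p).trans hmp).trans (le_add_of_nonneg_right ?_)
      positivity
    · have h1 := hpow (max (dist x (σ x)) (dist x (τ x))) (dist f (π f))
        (le_max_of_le_left dist_nonneg) dist_nonneg
      have h2 : dist f (π f) ^ p ≤
          ∑ f ∈ I, if x ∈ mismatch C σ γ f then dist f (π f) ^ p else 0 := by
        refine le_trans ?_ (Finset.single_le_sum (fun f _ => hite x f) hf)
        rw [if_pos hxf]
      have h3 : max (dist x (σ x) ^ p) (dist x (τ x) ^ p) ≤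
          dist x (σ x) ^ p + dist x (τ x) ^ p := max_le_add_of_nonneg (by positivity) (by positivity)
      calc dist x y ^ p ≤ (max (dist x (σ x)) (dist x (τ x)) + dist f (π f)) ^ p :=
            pow_le_pow_left₀ dist_nonneg hy p
        _ ≤ _ := h1
        _ ≤ (1 + η) * max (dist x (σ x) ^ p) (dist x (τ x) ^ p) +
            M * ∑ f ∈ I, if x ∈ mismatch C σ γ f then dist f (π f) ^ p else 0 := by gcongr
        _ ≤ _ := by
            have := mul_le_mul_of_nonneg_left h3 hη
            simp only [e]
            linarith
  · have hT := sum_reassign_cost_le (p := p) (C := C) (φ := φ) (F := F) hγ hη hpow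
    have hU := sum_mismatch_cost_le (p := p) (C := C) hσ hγ hε.le hε1 hπu
      fun f hf => (hI f hf).2
    have he : ∑ x ∈ C, e x = η * (cost p C L + ∑ x ∈ C, dist x (τ x) ^ p) +
        M * ∑ f ∈ I, (mismatch C σ γ f).card * dist f (π f) ^ p := by
      simp only [e]
      rw [Finset.sum_add_distrib, ← Finset.mul_sum, Finset.sum_add_distrib, cost_eq_sum_dist hσ,
        ← Finset.mul_sum, Finset.sum_comm]
      congr 2
      refine Finset.sum_congr rfl fun f _ => ?_
      rw [← Finset.sum_filter, Finset.filter_mem_eq_inter, Finset.inter_eq_right.mpr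
        (fun x hx => (mem_mismatch.mp hx).1), Finset.sum_const, nsmul_eq_mul]
    have hU' : M * ∑ f ∈ I, (mismatch C σ γ f).card * dist f (π f) ^ p ≤ η * W := by
      calc _ ≤ M * (2 * ε * 2 ^ p * W) := by gcongr
        _ = M * (2 * ε * 2 ^ p) * W := by ring
        _ ≤ η * W := by gcongr
    rw [he]
    have cL := cost_nonneg p C L
    have cG := cost_nonneg p C G
    set T := ∑ x ∈ C, dist x (τ x) ^ p with hTdef
    have hT' : T ≤ (1 + η) * cost p C G + η * W := hT.trans (by linarith)
    have h1 : (1 + η) * T ≤ (1 + η) * ((1 + η) * cost p C G + η * W) := by gcongr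
    have h2 : η * η ≤ η := by nlinarith
    have h3 : η * η * cost p C G ≤ η * cost p C G := by gcongr
    have h4 : η * η * W ≤ η * W := by gcongr
    have h5 : 0 ≤ η * cost p C L := by positivity
    have h6 : 0 ≤ η * cost p C G := by positivity
    have hWe : η * W = η * cost p C L + η * cost p C G := by rw [hW]; ring
    nlinarith

end

/-! ### Local optimality against grouped exchanges -/

section

universe u

theorem card_labelClass_comp {X J J' : Type*} {L : Finset X} {lam : X → J} {I : Finset J}
    (hlam : ∀ x ∈ L, lam x ∈ I) (grp : J → J') (g : J') :
    (labelClass L (grp ∘ lam) g).card = ∑ j ∈ labelClass I grp g, (labelClass L lam j).card := by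
  rw [card_eq_sum_card_labelClass (L := labelClass L (grp ∘ lam) g) (F := labelClass I grp g)
    (γ := lam) fun x hx => by
      rw [mem_labelClass] at hx ⊢
      exact ⟨hlam x hx.1, hx.2⟩]
  refine Finset.sum_congr rfl fun j hj => ?_
  congr 1
  ext x
  simp only [mem_labelClass]
  have := (mem_labelClass.mp hj).2
  constructor
  · rintro ⟨⟨h1, -⟩, h3⟩
    exact ⟨h1, h3⟩
  · rintro ⟨h1, h3⟩
    exact ⟨⟨h1, by rw [Function.comp, h3, this]⟩, h3⟩

open Classical in
theorem card_swapSet_le {X J : Type*} {L H : Finset X} {lam kap : X → J} {Z : J → Finset X} {g : J} :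
    (swapSet L H lam kap Z g).card + (labelClass L lam g).card ≤
      L.card + (labelClass H kap g).card + (Z g).card := by
  have h1 : (swapSet L H lam kap Z g).card ≤ _ := Finset.card_union_le _ _
  have h2 := Finset.card_union_le (L.filter fun u => lam u ≠ g) (labelClass H kap g)
  have h3 : (labelClass L lam g).card + (L.filter fun u => lam u ≠ g).card = L.card :=
    Finset.card_filter_add_card_filter_not _
  omega

open Classical in
theorem card_swapSet_symmDiff_le {X J : Type*} {L H : Finset X} {lam kap : X → J} {Z : J → Finset X}
    {g : J} : (L \ swapSet L H lam kap Z g).card + (swapSet L H lam kap Z g \ L).card ≤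
      (labelClass L lam g).card + (labelClass H kap g).card + (Z g).card := by
  have h1 : L \ swapSet L H lam kap Z g ⊆ labelClass L lam g := fun x hx => by
    obtain ⟨hxL, hx⟩ := Finset.mem_sdiff.mp hx
    refine mem_labelClass.mpr ⟨hxL, by_contra fun h => hx ?_⟩
    exact Finset.mem_union_left _ (Finset.mem_union_left _ (Finset.mem_filter.mpr ⟨hxL, h⟩))
  have h2 : swapSet L H lam kap Z g \ L ⊆ labelClass H kap g ∪ Z g := fun x hx => by
    obtain ⟨hx, hxL⟩ := Finset.mem_sdiff.mp hx
    rcases Finset.mem_union.mp hx with hx | hx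
    · rcases Finset.mem_union.mp hx with hx | hx
      · exact absurd (Finset.mem_filter.mp hx).1 hxL
      · exact Finset.mem_union_left _ hx
    · exact Finset.mem_union_right _ hx
  have h3 := Finset.card_le_card h1
  have h4 := (Finset.card_le_card h2).trans (Finset.card_union_le _ _)
  omega

variable {X : Type u} [MetricSpace X] {p : ℕ} {C L G : Finset X} {σ : X → X}

/-- Local optimality against a balanced family of small exchanges. -/
theorem cost_le_of_exchanges {J : Type*} {H : Finset X} {lam kap : X → J} {Z : J → Finset X}
    {e : X → ℝ} {τ : X → X} {k s r : ℕ} {ε : ℝ} (hL : L.card = k) (hH : H.card ≤ k)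
    (hC : C.Nonempty) (hε : 0 ≤ ε)
    (hσ : ∀ x, σ x ∈ L ∧ Metric.infDist x (L : Set X) = dist x (σ x))
    (hr : ∀ j, (labelClass L lam j).card + (labelClass H kap j).card + (Z j).card ≤ r)
    (hbal : ∀ I : Finset J, H.card + ∑ j ∈ I, (Z j).card ≤ k)
    (hτ : ∀ x, τ x ∈ H) (he : ∀ x, 0 ≤ e x) (hsub : HasSubstitutes p C L H lam kap Z σ τ e)
    (hs : (2 * r + 1) * 20 * r ≤ s) (hopt : ∀ S', ¬ Step p k s ε C L S') :
    ∃ R : ℕ, 10 * R ≤ k + 10 ∧ cost p C L ≤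
      ∑ x ∈ C, dist x (τ x) ^ p + ∑ x ∈ C, e x + R * (ε / C.card * cost p C L) := by
  classical
  set I : Finset J := L.image lam ∪ H.image kap with hI
  have hlam : ∀ u ∈ L, lam u ∈ I := fun u hu =>
    Finset.mem_union_left _ (Finset.mem_image_of_mem _ hu)
  have hkap : ∀ u ∈ H, kap u ∈ I := fun u hu =>
    Finset.mem_union_right _ (Finset.mem_image_of_mem _ hu)
  have hIc : I.card ≤ 2 * k := by
    have h1 := Finset.card_union_le (L.image lam) (H.image kap)
    have h2 := Finset.card_image_le (s := L) (f := lam)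
    have h3 := Finset.card_image_le (s := H) (f := kap)
    rw [← hI] at h1
    omega
  -- How many centers the exchange of label `j` closes in excess of those it opens.
  let a : J → ℤ := fun j =>
    (labelClass L lam j).card - (labelClass H kap j).card - (Z j).card
  have ha : ∀ j ∈ I, |a j| ≤ r := fun j _ => by
    have := hr j
    rw [abs_le]
    constructor <;> simp only [a] <;> omega
  have hsumL := card_eq_sum_card_labelClass hlam
  have hsumH := card_eq_sum_card_labelClass hkap
  have hsum : 0 ≤ ∑ j ∈ I, a j := by
    simp only [a, Finset.sum_sub_distrib]
    have := hbal I
    have e1 : (∑ j ∈ I, ((labelClass L lam j).card : ℤ)) = L.card := by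
      rw [hsumL]; push_cast; rfl
    have e2 : (∑ j ∈ I, ((labelClass H kap j).card : ℤ)) = H.card := by
      rw [hsumH]; push_cast; rfl
    have e3 : (∑ j ∈ I, ((Z j).card : ℤ)) = ((∑ j ∈ I, (Z j).card : ℕ) : ℤ) := by push_cast; rfl
    rw [e1, e2, e3]
    omega
  -- At most `2 * k` labels occur, so group size 20 leaves at most `k / 10 + 1` exchanges.
  obtain ⟨R, grp, hgR, hRq, hgrp⟩ := exists_balanced_grouping I a r 20 (by norm_num) ha hsum
  refine ⟨R, by omega, ?_⟩
  have hsub' := hsub.comp I (fun x _ => hlam _ (hσ x).1) grp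
  set Zg : ℕ → Finset X := fun g => (labelClass I grp g).biUnion Z with hZg
  have hmain := sum_swap_cost_le (lam := grp ∘ lam) (kap := grp ∘ kap) (Finset.range R) hσ (fun x _ => hτ x)
    (fun u hu => Finset.mem_range.mpr (hgR _ (hlam u hu)))
    (fun u hu => Finset.mem_range.mpr (hgR _ (hkap u hu))) (fun x _ => he x) hsub'
  have hstep : ∀ g ∈ Finset.range R, -(ε / C.card * cost p C L) ≤
      cost p C (swapSet L H (grp ∘ lam) (grp ∘ kap) Zg g) - cost p C L := by
    intro g _
    have cL := card_labelClass_comp hlam grp g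
    have cH := card_labelClass_comp hkap grp g
    have cZ : (Zg g).card ≤ ∑ j ∈ labelClass I grp g, (Z j).card := Finset.card_biUnion_le
    have hg := hgrp g
    have hbalg : ∑ j ∈ labelClass I grp g, (labelClass H kap j).card +
        ∑ j ∈ labelClass I grp g, (Z j).card ≤
        ∑ j ∈ labelClass I grp g, (labelClass L lam j).card := by
      have h0 := hg.1
      simp only [a, Finset.sum_sub_distrib] at h0
      zify
      linarith
    have hsize : ∑ j ∈ labelClass I grp g, (labelClass L lam j).card +
        ∑ j ∈ labelClass I grp g, (labelClass H kap j).card +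
        ∑ j ∈ labelClass I grp g, (Z j).card ≤ s := by
      rw [← Finset.sum_add_distrib, ← Finset.sum_add_distrib]
      refine (Finset.sum_le_card_nsmul _ _ r fun j _ => hr j).trans ?_
      rw [smul_eq_mul]
      exact (Nat.mul_le_mul_right r hg.2).trans hs
    have h1 := card_swapSet_le (L := L) (H := H) (lam := grp ∘ lam) (kap := grp ∘ kap) (Z := Zg)
      (g := g)
    have h2 := card_swapSet_symmDiff_le (L := L) (H := H) (lam := grp ∘ lam) (kap := grp ∘ kap)
      (Z := Zg) (g := g)
    obtain ⟨x, hx⟩ := hC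
    obtain ⟨α, β, -, hy⟩ := exists_mem_swapSet (fun x => (hσ x).1) (fun x _ => hτ x)
      (fun x _ => he x) hsub' hx
    obtain ⟨y, hy, -⟩ := hy g
    by_contra hcon
    push Not at hcon
    have hcL := cost_nonneg p C L
    have h3 : 0 ≤ ε / C.card * cost p C L := by positivity
    refine hopt _ ⟨⟨⟨y, hy⟩, by omega⟩, ?_, ?_, ?_⟩
    · have h4 := h2.trans (show _ ≤ s by omega)
      convert h4
    · linarith
    · linarith
  have hsumstep := Finset.card_nsmul_le_sum _ _ _ hstep
  rw [Finset.card_range, nsmul_eq_mul] at hsumstep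
  have := hsumstep.trans hmain
  linarith

/-- A locally optimal solution is a `1 + ε` approximation, for suitable parameters. -/
theorem cost_le_of_locally_optimal {k s : ℕ} {η M ε₁ δ r ε : ℝ} (hk : 0 < k) (hL : L.card = k)
    (hG : G.card = k) (hkC : k < C.card) (hε : 0 < ε) (hε2 : ε < 1 / 2) (hη : η = ε / 800)
    (hM : 0 ≤ M) (hε₁ : 0 < ε₁) (hε₁' : ε₁ ≤ 1 / 2) (hδ : 0 < δ) (hδ1 : δ ≤ 1 / 12)
    (hpow : ∀ a b : ℝ, 0 ≤ a → 0 ≤ b → (a + b) ^ p ≤ (1 + η) * a ^ p + M * b ^ p)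
    (hMε : M * (2 * ε₁ * 2 ^ p) ≤ η) (hMδ : M * (24 * 4 ^ p * δ) ≤ η * ε₁) (hr : 2 / δ ≤ r)
    (hdiv : HasDivisions X (δ / 4) r)
    (hs : (2 * ⌊2 * r⌋₊ + 1) * 20 * ⌊2 * r⌋₊ ≤ s) (hopt : ∀ S', ¬ Step p k s ε C L S') :
    cost p C L ≤ (1 + ε) * cost p C G := by
  obtain ⟨σ, hσ⟩ := exists_nearest L (Finset.card_pos.mp (by omega))
  obtain ⟨J, H, lam, kap, Z, e, τ, hHG, hJr, hbal, hτ, he, hsub, hsum⟩ :=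
    exists_exchange_structure (C := C) hL hG hσ hk (by linarith) (by linarith) hM hε₁ hε₁' hδ hδ1
      hpow hMε hMδ hr hdiv
  obtain ⟨R, hR, hcost⟩ := cost_le_of_exchanges hL (hG ▸ Finset.card_le_card hHG)
    (Finset.card_pos.mp (by omega)) hε.le hσ (fun j => Nat.le_floor (hJr j)) hbal hτ he hsub hs hopt
  have hn : (2 : ℝ) ≤ C.card := by exact_mod_cast (by omega : 2 ≤ C.card)
  have hkn : (k : ℝ) ≤ C.card := by exact_mod_cast hkC.le
  have hR' : 10 * (R : ℝ) ≤ k + 10 := by exact_mod_cast hR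
  have cL := cost_nonneg p C L
  have cG := cost_nonneg p C G
  have h1 : R * (ε / C.card * cost p C L) ≤ 3 / 5 * ε * cost p C L := by
    -- `R ≤ k / 10 + 1`, `k ≤ n` and `n ≥ 2` give `1 / 10 + 1 / 2`.
    have h2 : (R : ℝ) / C.card ≤ 3 / 5 := by
      rw [div_le_iff₀ (by linarith)]
      linarith
    calc R * (ε / C.card * cost p C L) = (R : ℝ) / C.card * (ε * cost p C L) := by ring
      _ ≤ 3 / 5 * (ε * cost p C L) := by gcongr
      _ = _ := by ring
  rw [hη] at hsum
  -- The error `8 * η` is `ε / 100`, and `61 / 100 = 3 / 5 + 1 / 100`.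
  have h3 : (1 - 61 / 100 * ε) * cost p C L ≤ (1 + 1 / 100 * ε) * cost p C G := by linarith
  have h4 : 1 + 1 / 100 * ε ≤ (1 - 61 / 100 * ε) * (1 + ε) := by nlinarith
  have h5 : (1 - 61 / 100 * ε) * cost p C L ≤
      (1 - 61 / 100 * ε) * ((1 + ε) * cost p C G) := by
    refine h3.trans ?_
    rw [← mul_assoc]
    gcongr
  exact le_of_mul_le_mul_left h5 (by linarith)

end

/-! ### Available steps and termination -/

section

variable {X : Type*} [MetricSpace X] {p : ℕ} {C S : Finset X}

open Classical in
/-- Opening a center at the most expensive client is a valid step if some center can be spared. -/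
theorem exists_step_of_pos {k s : ℕ} {ε : ℝ} (hp : 0 < p) (hs : 2 ≤ s) (hε : ε ≤ 1)
    (hS : IsSolution k S) (hpos : 0 < cost p C S) (h : S.card < k ∨ C.card ≤ k) :
    ∃ S', Step p k s ε C S S' := by
  obtain ⟨σ, hσ⟩ := exists_nearest S hS.1
  have hC : C.Nonempty := by
    rcases C.eq_empty_or_nonempty with rfl | h
    · simp [cost] at hpos
    · exact h
  have hn : (0 : ℝ) < C.card := by exact_mod_cast Finset.card_pos.mpr hC
  -- The most expensive client carries at least a share `1 / n` of the cost, so opening it is a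
  -- sufficient gain if no other client loses its center.
  obtain ⟨x, hx, hmax⟩ := C.exists_max_image (fun y => Metric.infDist y (S : Set X) ^ p) hC
  have hxc : cost p C S ≤ C.card * Metric.infDist x (S : Set X) ^ p := by
    rw [← nsmul_eq_mul]
    exact Finset.sum_le_card_nsmul _ _ _ hmax
  have improve : ∀ S' : Finset X, x ∈ S' → (∀ y ∈ C, y ≠ x → σ y ∈ S') →
      S'.card ≤ k → (S \ S').card + (S' \ S).card ≤ s → Step p k s ε C S S' := by
    intro S' hxS' hS' hk hdiff
    have hle : cost p C S' ≤ cost p C S - Metric.infDist x (S : Set X) ^ p := by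
      rw [cost, cost, ← Finset.add_sum_erase _ _ hx, ← Finset.add_sum_erase C (fun y =>
        Metric.infDist y (S : Set X) ^ p) hx, Metric.infDist_zero_of_mem (by exact_mod_cast hxS'),
        zero_pow hp.ne']
      have : ∑ y ∈ C.erase x, Metric.infDist y (S' : Set X) ^ p ≤
          ∑ y ∈ C.erase x, Metric.infDist y (S : Set X) ^ p := by
        refine Finset.sum_le_sum fun y hy => ?_
        obtain ⟨hyx, hyC⟩ := Finset.mem_erase.mp hy
        rw [(hσ y).2]
        exact pow_le_pow_left₀ Metric.infDist_nonneg
          (Metric.infDist_le_dist_of_mem (hS' y hyC hyx)) p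
      linarith
    have hq : cost p C S / C.card ≤ Metric.infDist x (S : Set X) ^ p := by
      rw [div_le_iff₀ hn]
      linarith
    have hq0 : 0 < cost p C S / C.card := by positivity
    refine ⟨⟨⟨x, hxS'⟩, hk⟩, hdiff, ?_, by linarith⟩
    have : ε / C.card * cost p C S ≤ cost p C S / C.card := by
      rw [div_mul_eq_mul_div]
      gcongr
      nlinarith
    linarith
  by_cases hlt : S.card < k
  · refine ⟨insert x S, improve _ (Finset.mem_insert_self _ _)
      (fun y _ _ => Finset.mem_insert_of_mem (hσ y).1)
      ((Finset.card_insert_le _ _).trans hlt) ?_⟩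
    have h1 : S \ insert x S = ∅ := Finset.sdiff_eq_empty_iff_subset.mpr (Finset.subset_insert _ _)
    have h2 : insert x S \ S ⊆ {x} := fun y hy => by
      simp only [Finset.mem_sdiff, Finset.mem_insert] at hy
      simp only [Finset.mem_singleton]
      tauto
    have h3 := Finset.card_le_card h2
    rw [h1, Finset.card_empty]
    rw [Finset.card_singleton] at h3
    omega
  · have hCk : C.card ≤ k := h.resolve_left hlt
    have hSk : S.card = k := le_antisymm hS.2 (not_lt.mp hlt)
    -- The other clients number at most `k - 1`, so some center serves none of them.
    obtain ⟨u, huS, hu⟩ : ∃ u ∈ S, u ∉ (C.erase x).image σ := by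
      apply Finset.exists_mem_notMem_of_card_lt_card
      have h1 := Finset.card_image_le (s := C.erase x) (f := σ)
      have h2 := Finset.card_erase_lt_of_mem hx
      omega
    refine ⟨insert x (S.erase u), improve _ (Finset.mem_insert_self _ _) (fun y hy hyx => ?_) ?_ ?_⟩
    · refine Finset.mem_insert_of_mem (Finset.mem_erase.mpr ⟨fun h => hu ?_, (hσ y).1⟩)
      rw [← h]
      exact Finset.mem_image_of_mem _ (Finset.mem_erase.mpr ⟨hyx, hy⟩)
    · have h1 := Finset.card_insert_le x (S.erase u)
      have h2 := Finset.card_erase_lt_of_mem huS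
      omega
    · have h1 : S \ insert x (S.erase u) ⊆ {u} := fun y hy => by
        simp only [Finset.mem_sdiff, Finset.mem_insert, Finset.mem_erase] at hy
        simp only [Finset.mem_singleton]
        tauto
      have h2 : insert x (S.erase u) \ S ⊆ {x} := fun y hy => by
        simp only [Finset.mem_sdiff, Finset.mem_insert, Finset.mem_erase] at hy
        simp only [Finset.mem_singleton]
        tauto
      have h3 := Finset.card_le_card h1
      have h4 := Finset.card_le_card h2
      rw [Finset.card_singleton] at h3 h4
      omega

/-- With fewer centers than clients, the cost is bounded away from zero. -/
theorem exists_cost_lower_bound (p : ℕ) {k : ℕ} (hk : k < C.card) :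
    ∃ b : ℝ, 0 < b ∧ ∀ S, IsSolution k S → b ≤ cost p C S := by
  classical
  obtain ⟨m, hm0, hm⟩ : ∃ m : ℝ, 0 < m ∧ ∀ x ∈ C, ∀ y ∈ C, x ≠ y → m ≤ dist x y := by
    rcases C.offDiag.eq_empty_or_nonempty with h | h
    · refine ⟨1, one_pos, fun x hx y hy hxy => ?_⟩
      have : (x, y) ∈ C.offDiag := Finset.mem_offDiag.mpr ⟨hx, hy, hxy⟩
      simp [h] at this
    · obtain ⟨q, hq, hmin⟩ := C.offDiag.exists_min_image (fun q => dist q.1 q.2) h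
      refine ⟨dist q.1 q.2, dist_pos.mpr (Finset.mem_offDiag.mp hq).2.2, fun x hx y hy hxy => ?_⟩
      exact hmin (x, y) (Finset.mem_offDiag.mpr ⟨hx, hy, hxy⟩)
  refine ⟨(m / 2) ^ p, by positivity, fun S hS => ?_⟩
  obtain ⟨σ, hσ⟩ := exists_nearest S hS.1
  -- Two clients share a center, and one of them is at least `m / 2` away from it.
  obtain ⟨x, hx, y, hy, hxy, hσxy⟩ := Finset.exists_ne_map_eq_of_card_lt_of_maps_to
    (hS.2.trans_lt hk) (f := σ) fun z _ => (hσ z).1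
  have hd := hm x hx y hy hxy
  have htri := dist_triangle_right x y (σ x)
  have key : ∀ z ∈ C, m / 2 ≤ dist z (σ z) → (m / 2) ^ p ≤ cost p C S := fun z hz hzm => by
    rw [cost_eq_sum_dist hσ]
    refine (pow_le_pow_left₀ (by positivity) hzm p).trans ?_
    exact Finset.single_le_sum (f := fun z => dist z (σ z) ^ p) (fun _ _ => by positivity) hz
  rcases le_total (m / 2) (dist x (σ x)) with h | h
  · exact key x hx h
  · refine key y hy ?_
    rw [← hσxy]
    linarith

theorem not_exists_infiniteRun {k s : ℕ} {ε : ℝ} {S₀ : Finset X} (hε : 0 < ε) (hε1 : ε ≤ 1)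
    (hk : k < C.card) : ¬ ∃ run, IsInfiniteRun p k s ε C S₀ run := by
  rintro ⟨run, -, hrun⟩
  obtain ⟨b, hb, hlow⟩ := exists_cost_lower_bound p hk
  have hn : (1 : ℝ) ≤ C.card := by exact_mod_cast (by omega : 1 ≤ C.card)
  have hq1 : ε / C.card ≤ 1 := by
    rw [div_le_one (by linarith)]
    linarith
  have hq0 : 0 < ε / C.card := by positivity
  have hle : ∀ i, cost p C (run i) ≤ (1 - ε / C.card) ^ i * cost p C (run 0) := by
    intro i
    induction i with
    | zero => simp
    | succ i ih =>
      refine (hrun i).2.2.1.trans ?_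
      rw [pow_succ', mul_assoc]
      exact mul_le_mul_of_nonneg_left ih (by linarith)
  have hlim : Filter.Tendsto (fun i : ℕ => (1 - ε / C.card) ^ i * cost p C (run 0))
      Filter.atTop (nhds (0 * cost p C (run 0))) :=
    (tendsto_pow_atTop_nhds_zero_of_lt_one (by linarith) (by linarith)).mul_const _
  rw [zero_mul] at hlim
  -- Geometric decay takes the cost below its lower bound. The index must be positive because only
  -- the results of steps are known to be solutions.
  obtain ⟨i, hi1, hi2⟩ := ((hlim.eventually (gt_mem_nhds hb)).and
    (Filter.eventually_ge_atTop 1)).exists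
  have hsol : IsSolution k (run i) := by
    obtain ⟨j, rfl⟩ : ∃ j, i = j + 1 := ⟨i - 1, by omega⟩
    exact (hrun j).1
  linarith [hle i, hlow _ hsol]

/-! ### Polynomially bounded parameters -/

/-- Positive functions on `(0, 1/2)` bounded by a power of `1 / ε`. -/
def PolyBounded (f : ℝ → ℝ) : Prop :=
  ∃ c : ℕ, ∀ ε : ℝ, 0 < ε → ε < 1 / 2 → 0 ≤ f ε ∧ f ε ≤ (1 / ε) ^ c

namespace PolyBounded

variable {f g : ℝ → ℝ}

theorem two_le_one_div {ε : ℝ} (h0 : 0 < ε) (h1 : ε < 1 / 2) : 2 ≤ 1 / ε := by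
  rw [le_div_iff₀ h0]
  linarith

theorem const {a : ℝ} (ha : 0 ≤ a) : PolyBounded fun _ => a := by
  obtain ⟨c, hc⟩ := pow_unbounded_of_one_lt a (one_lt_two)
  exact ⟨c, fun ε h0 h1 => ⟨ha, hc.le.trans (pow_le_pow_left₀ (by norm_num)
    (two_le_one_div h0 h1) c)⟩⟩

theorem one_div : PolyBounded fun ε => 1 / ε :=
  ⟨1, fun ε h0 _ => ⟨by positivity, by rw [pow_one]⟩⟩

theorem mul (hf : PolyBounded f) (hg : PolyBounded g) : PolyBounded fun ε => f ε * g ε := by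
  obtain ⟨a, ha⟩ := hf
  obtain ⟨b, hb⟩ := hg
  refine ⟨a + b, fun ε h0 h1 => ⟨mul_nonneg (ha ε h0 h1).1 (hb ε h0 h1).1, ?_⟩⟩
  rw [pow_add]
  exact mul_le_mul (ha ε h0 h1).2 (hb ε h0 h1).2 (hb ε h0 h1).1 (by positivity)

theorem add (hf : PolyBounded f) (hg : PolyBounded g) : PolyBounded fun ε => f ε + g ε := by
  obtain ⟨a, ha⟩ := hf
  obtain ⟨b, hb⟩ := hg
  refine ⟨a + b + 1, fun ε h0 h1 => ⟨add_nonneg (ha ε h0 h1).1 (hb ε h0 h1).1, ?_⟩⟩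
  have h2 := two_le_one_div h0 h1
  have h3 : f ε ≤ (1 / ε) ^ (a + b) :=
    (ha ε h0 h1).2.trans (pow_le_pow_right₀ (by linarith) (by omega))
  have h4 : g ε ≤ (1 / ε) ^ (a + b) :=
    (hb ε h0 h1).2.trans (pow_le_pow_right₀ (by linarith) (by omega))
  have h5 : 0 ≤ (1 / ε) ^ (a + b) := by positivity
  rw [pow_succ]
  nlinarith

theorem pow (hf : PolyBounded f) (n : ℕ) : PolyBounded fun ε => f ε ^ n := by
  obtain ⟨a, ha⟩ := hf
  refine ⟨a * n, fun ε h0 h1 => ⟨pow_nonneg (ha ε h0 h1).1 n, ?_⟩⟩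
  rw [pow_mul]
  exact pow_le_pow_left₀ (ha ε h0 h1).1 (ha ε h0 h1).2 n

end PolyBounded

/-- A choice of the parameters of the analysis, polynomial in `1 / ε`. -/
theorem exists_parameters (p d A : ℕ) :
    ∃ c : ℕ, ∀ ε : ℝ, 0 < ε → ε < 1 / 2 → ∃ M ε₁ δ r : ℝ,
      0 ≤ M ∧ 0 < ε₁ ∧ ε₁ ≤ 1 / 2 ∧ 0 < δ ∧ δ ≤ 1 / 12 ∧
      (∀ a b : ℝ, 0 ≤ a → 0 ≤ b → (a + b) ^ p ≤ (1 + ε / 800) * a ^ p + M * b ^ p) ∧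
      M * (2 * ε₁ * 2 ^ p) ≤ ε / 800 ∧ M * (24 * 4 ^ p * δ) ≤ ε / 800 * ε₁ ∧ 2 / δ ≤ r ∧
      A * (1 / (δ / 4)) ^ (2 * d) ≤ r ∧
      (2 * ⌊2 * r⌋₊ + 1) * 20 * ⌊2 * r⌋₊ ≤ ⌊1 / ε ^ c⌋₊ := by
  -- The reciprocals of `η`, `ε₁`, `δ`, which grow polynomially in `1 / ε`. The choices of `ε₁` and
  -- `δ` turn the two smallness conditions involving `M` into equalities.
  let iη : ℝ → ℝ := fun ε => 800 * (1 / ε)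
  let M : ℝ → ℝ := fun ε => (1 + 2 ^ p * iη ε) ^ p
  let iε₁ : ℝ → ℝ := fun ε => (M ε * (2 * 2 ^ p)) * iη ε
  let iδ : ℝ → ℝ := fun ε => (M ε * (24 * 4 ^ p)) * (iη ε * iε₁ ε)
  let r : ℝ → ℝ := fun ε => A * (4 * iδ ε) ^ (2 * d) + 2 * iδ ε
  have hη : PolyBounded iη := (PolyBounded.const (by norm_num)).mul .one_div
  have hM : PolyBounded M :=
    ((PolyBounded.const (by norm_num)).add ((PolyBounded.const (by positivity)).mul hη)).pow p
  have hε₁ : PolyBounded iε₁ := (hM.mul (.const (by positivity))).mul hη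
  have hδ : PolyBounded iδ := (hM.mul (.const (by positivity))).mul (hη.mul hε₁)
  have hr : PolyBounded r :=
    ((PolyBounded.const (Nat.cast_nonneg A)).mul
      (((PolyBounded.const (by norm_num)).mul hδ).pow (2 * d))).add
      ((PolyBounded.const (by norm_num)).mul hδ)
  have h2r : PolyBounded fun ε => 2 * r ε := (PolyBounded.const (by norm_num)).mul hr
  obtain ⟨c, hc⟩ := ((((PolyBounded.const (a := 2) (by norm_num)).mul h2r).add
    (.const (a := 1) (by norm_num))).mul (.const (a := 20) (by norm_num))).mul h2r
  refine ⟨c, fun ε h0 h1 => ?_⟩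
  have pη : iη ε = 1 / (ε / 800) := by simp only [iη]; field_simp
  have pη1 : 1 ≤ iη ε := by
    have := PolyBounded.two_le_one_div h0 h1
    simp only [iη]
    linarith
  have p2 : (1 : ℝ) ≤ 2 ^ p := one_le_pow₀ (by norm_num)
  have p4 : (1 : ℝ) ≤ 4 ^ p := one_le_pow₀ (by norm_num)
  have pM1 : 1 ≤ M ε := one_le_pow₀ (by nlinarith)
  have pε₁ : 2 ≤ iε₁ ε := by
    have : 2 ≤ M ε * (2 * 2 ^ p) := by nlinarith
    simp only [iε₁]
    nlinarith
  have pδ : 12 ≤ iδ ε := by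
    have h2 : 12 ≤ M ε * (24 * 4 ^ p) := by nlinarith
    have h3 : 1 ≤ iη ε * iε₁ ε := by nlinarith
    simp only [iδ]
    nlinarith
  have hrn : 0 ≤ r ε := by
    simp only [r]
    positivity
  refine ⟨M ε, 1 / iε₁ ε, 1 / iδ ε, r ε, by linarith, by positivity, ?_, by positivity, ?_, ?_,
    ?_, ?_, ?_, ?_, ?_⟩
  · exact one_div_le_one_div_of_le (by norm_num) pε₁
  · exact one_div_le_one_div_of_le (by norm_num) pδ
  · intro a b ha hb
    have := add_pow_le_relaxed p (η := ε / 800) (by positivity) (by linarith) ha hb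
    have e : M ε = (1 + 2 ^ p / (ε / 800)) ^ p := by
      simp only [M, pη]
      rw [mul_one_div]
    rw [e]
    exact this
  · apply le_of_eq
    have e : ε / 800 = 1 / iη ε := by rw [pη]; simp
    rw [e]
    simp only [iε₁]
    have : M ε ≠ 0 := by linarith
    have : iη ε ≠ 0 := by linarith
    field_simp
  · apply le_of_eq
    have e : ε / 800 = 1 / iη ε := by rw [pη]; simp
    rw [e]
    simp only [iδ]
    have : M ε ≠ 0 := by linarith
    have : iη ε ≠ 0 := by linarith
    have : iε₁ ε ≠ 0 := by linarith
    field_simp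
  · have : 0 ≤ A * (4 * iδ ε) ^ (2 * d) := by positivity
    rw [div_div_eq_mul_div, div_one]
    simp only [r]
    linarith
  · have e : 1 / (1 / iδ ε / 4) = 4 * iδ ε := by
      have : iδ ε ≠ 0 := by linarith
      field_simp
    rw [e]
    simp only [r]
    linarith
  · apply Nat.le_floor
    have h2 := (hc ε h0 h1).2
    rw [one_div_pow] at h2
    refine le_trans ?_ h2
    have h3 : (⌊2 * r ε⌋₊ : ℝ) ≤ 2 * r ε := Nat.floor_le (by linarith)
    push_cast
    gcongr

end

end KClustering

/-! ### The main theorem -/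

open KClustering in
theorem mainTheorem2 (p d : ℕ) (hp : 0 < p) (hd : 0 < d) :
    ∃ c : ℕ, ∀ ε : ℝ, 0 < ε → ε < 1 / 2 →
      ∀ (k : ℕ), 0 < k → ∀ (C S₀ : Finset (EuclideanSpace ℝ (Fin d))), S₀.card = k →
        -- every output is a solution of cost at most `1 + ε` times the minimum
        (∀ S, KClustering.IsOutput p k ⌊1 / ε ^ c⌋₊ ε C S₀ S →
          KClustering.IsSolution k S ∧
          ∀ T, KClustering.IsSolution k T →
            KClustering.cost p C S ≤ (1 + ε) * KClustering.cost p C T) ∧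
        -- unless the minimum is zero, the algorithm always halts
        (k < C.card → ¬ ∃ run, KClustering.IsInfiniteRun p k ⌊1 / ε ^ c⌋₊ ε C S₀ run) := by
  classical
  obtain ⟨A, hA⟩ := exists_division hd
  obtain ⟨c, hc⟩ := exists_parameters p d A
  refine ⟨c, fun ε hε hε2 k hk C S₀ hS₀ => ⟨?_, fun hkC =>
    not_exists_infiniteRun hε (by linarith) hkC⟩⟩
  rintro S ⟨hreach, hopt⟩
  have hsol : IsSolution k S := by
    rcases hreach.cases_tail with h | ⟨S', -, h⟩
    · subst h
      exact ⟨Finset.card_pos.mp (by omega), hS₀.le⟩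
    · exact h.1
  refine ⟨hsol, fun T hT => ?_⟩
  have cT := cost_nonneg p C T
  rcases (cost_nonneg p C S).eq_or_lt with h0 | hpos
  · rw [← h0]
    positivity
  obtain ⟨M, ε₁, δ, r, hM, hε₁, hε₁', hδ, hδ1, hpow, hMε, hMδ, hr, hAr, hs⟩ := hc ε hε hε2
  have hs2 : 2 ≤ ⌊1 / ε ^ c⌋₊ := by
    have h1 : 1 ≤ ⌊2 * r⌋₊ := by
      apply Nat.le_floor
      have : 2 ≤ 2 / δ := by
        rw [le_div_iff₀ hδ]
        linarith
      push_cast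
      linarith
    nlinarith
  -- A local optimum of positive cost uses all `k` centers, and there are more than `k` clients.
  have hnot : ¬ (S.card < k ∨ C.card ≤ k) := fun h =>
    (exists_step_of_pos hp hs2 (by linarith) hsol hpos h).elim hopt
  push Not at hnot
  have hSk : S.card = k := le_antisymm hsol.2 hnot.1
  -- Padding `T` with clients to exactly `k` centers does not raise its cost.
  obtain ⟨G, hTG, -, hGk⟩ := Finset.exists_subsuperset_card_eq
    (Finset.subset_union_left (s₁ := T) (s₂ := C)) hT.2
    (hnot.2.le.trans (Finset.card_le_card Finset.subset_union_right))
  have hdiv : HasDivisions (EuclideanSpace ℝ (Fin d)) (δ / 4) r := fun P => by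
    obtain ⟨ι, hι, lab, Z, h1, h2, h3⟩ := hA (δ / 4) (by positivity) (by linarith) P
    exact ⟨ι, hι, lab, Z, fun i => (h1 i).trans hAr, h2, h3⟩
  calc cost p C S ≤ (1 + ε) * cost p C G :=
        cost_le_of_locally_optimal hk hSk hGk hnot.2 hε hε2 rfl hM hε₁ hε₁' hδ hδ1 hpow hMε hMδ hr
          hdiv hs hopt
    _ ≤ (1 + ε) * cost p C T := by
        gcongr
        exact cost_anti hT.1 hTG
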